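/- Let $A=\{-1,+1\}$ and $\mathcal X=A^{\{0,-1,-2,\dots\}}$ with its product (Borel) $\sigma$-algebra $\mathcal B$, and let $T:\mathcal X\to\mathcal X$, $(Tx)_i=x_{i-1}$ for $i\le 0$. For $a\in A$ and $x\in\mathcal X$ let $ax\in\mathcal X$ be the sequence with $(ax)_0=a$ and $(ax)_{i-1}=x_i$ for $i\le 0$. A probability measure $\mu$ on $\mathcal X$ is a stationary measure compatible with $g:\mathcal X\to[0,1]$ if it is $T$-invariant and, for every $a\in A$, $\mu(x_0=a\mid T^{-1}\mathcal B)(x)=g(a\,Tx)$ for $\mu$-almost every $x$. Let $\epsilon\in(0,1/2)$, let $(m_j)_{j\ge1}$ be a strictly increasing sequence of positive odd integers, and let $(\lambda_j)_{j\ge1}$ be positive reals with $\sum_{j\ge1}\lambda_j=1$. The Bramson–Kalikow model is the function $$p(x)=\sum_{j\ge1}\lambda_j\,p_{[m_j]}(x),\qquad p_{[m]}(x)=(1-\epsilon)\,\mathbf 1\Big\{x_0\sum_{l=1}^{m}x_{-l}>0\Big\}+\epsilon\,\mathbf 1\Big\{x_0\sum_{l=1}^{m}x_{-l}<0\Big\}.$$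 Put $m_0=0$, let $r:\{1,2,\dots\}\to\{0,1,2,\dots\}$ satisfy $r(k)<k$ for all $k\ge1$, and let $0<\alpha<\frac12-\epsilon$. Assume that for all $k\ge0$ $$\sum_{j\ge k+2}\lambda_j>\sum_{j=r(k+1)+1}^{k+1}\lambda_j\qquad\text{and}\qquad m_{k+1}\ge\frac{A_k}{\Big(\sum_{j\ge k+2}\lambda_j-\sum_{j=r(k+1)+1}^{k+1}\lambda_j\Big)^2},$$ where $$A_k=8(1-2\epsilon)^{-2}\big(1+m_{r(k+1)}(2\epsilon)^{-m_{r(k+1)}}\big)^2\ln\Big(2^{k+2}\big(1+m_k(2\epsilon)^{-m_k}\big)\alpha^{-1}\Big).$$ Then there exist at least two distinct stationary probability measures on $\mathcal X$ compatible with $p$. -/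

import Mathlib

open MeasureTheory

/-- One-sided sequences over an alphabet `A`, indexed by the non-positive integers:
for `x : Past A` and `n : ℕ`, the entry `x n` is the coordinate `x_{-n}`. The `σ`-algebra
is the product one, which for a finite alphabet is the Borel `σ`-algebra. -/
abbrev Past (A : Type*) := ℕ → A

namespace Past

/-- The shift `T`, `(T x)_i = x_{i-1}` for `i ≤ 0`: it forgets the coordinate `x_0`. -/
def shift {A : Type*} (x : Past A) : Past A := fun n => x (n + 1)

/-- The concatenation `a x`: its coordinate at `0` is `a`, and `x` is the past of `a`. -/
def cons {A : Type*} (a : A) (x : Past A) : Past A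
  | 0 => a
  | n + 1 => x n

end Past

/-- `μ` is a probability measure compatible with `g` (a `g`-measure): it is invariant under
the shift, and, for every letter `a`, the conditional probability of `x_0 = a` given
the past `T⁻¹ 𝓑 = σ(x_{-1}, x_{-2}, …)` is `g (a x_{-1} x_{-2} ⋯)`. -/
structure IsGMeasure {A : Type*} [Finite A] [MeasurableSpace A] [DiscreteMeasurableSpace A]
    (g : Past A → ℝ) (μ : Measure (Past A)) : Prop where
  isProbabilityMeasure : IsProbabilityMeasure μ
  invariant : MeasurePreserving Past.shift μ μ
  condProb : ∀ a : A,
    μ[Set.indicator {x : Past A | x 0 = a} (fun _ => (1 : ℝ)) |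
        MeasurableSpace.comap Past.shift inferInstance]
      =ᵐ[μ] fun x => g (Past.cons a (Past.shift x))

/-- Every subset of the alphabet `{-1, +1} = ℤˣ` is measurable. -/
instance instDiscreteMeasurableSpaceIntUnits : DiscreteMeasurableSpace ℤˣ where
  forall_measurableSet s :=
    ⟨Units.val '' s, MeasurableSet.of_discrete, Set.preimage_image_eq s Units.val_injective⟩

namespace BramsonKalikow

/-- The kernel `p_{[m]}` on sequences over the alphabet `{-1, +1} = ℤˣ`: the symbol `x_0`
agrees with the majority of the `m` preceding ones with probability `1 - ε`, and
disagrees with it with probability `ε`. -/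
noncomputable def majorityKernel (ε : ℝ) (m : ℕ) (x : Past ℤˣ) : ℝ :=
  (if 0 < (x 0 : ℤ) * ∑ l ∈ Finset.Icc 1 m, (x l : ℤ) then 1 - ε else 0) +
    (if (x 0 : ℤ) * ∑ l ∈ Finset.Icc 1 m, (x l : ℤ) < 0 then ε else 0)

/-- The Bramson–Kalikow function `p = ∑_{j ≥ 1} λ_j p_{[m_j]}`; the values `lam 0` and `m 0`
play no role. -/
noncomputable def kernel (ε : ℝ) (lam : ℕ → ℝ) (m : ℕ → ℕ) (x : Past ℤˣ) : ℝ :=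
  ∑' j : ℕ, lam (j + 1) * majorityKernel ε (m (j + 1)) x

/-- The difference `∑_{j ≥ k+2} λ_j - ∑_{j = r(k+1)+1}^{k+1} λ_j`. -/
noncomputable def gap (lam : ℕ → ℝ) (r : ℕ → ℕ) (k : ℕ) : ℝ :=
  (∑' j : ℕ, lam (k + 2 + j)) - ∑ j ∈ Finset.Icc (r (k + 1) + 1) (k + 1), lam j

/-- The constant `A_k`, equal to
`8 (1-2ε)⁻² (1 + m_{r(k+1)} (2ε)^{-m_{r(k+1)}})² ln (2^{k+2} (1 + m_k (2ε)^{-m_k}) α⁻¹)`. -/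
noncomputable def constA (ε α : ℝ) (m r : ℕ → ℕ) (k : ℕ) : ℝ :=
  8 * (1 - 2 * ε) ^ (-2 : ℤ) *
    (1 + (m (r (k + 1)) : ℝ) * (2 * ε) ^ (-(m (r (k + 1)) : ℤ))) ^ 2 *
    Real.log (2 ^ (k + 2) * (1 + (m k : ℝ) * (2 * ε) ^ (-(m k : ℤ))) * α⁻¹)

end BramsonKalikow

namespace BramsonKalikow

open Filter Topology

/-! It suffices to show that the full chain started from the all-plus past has mean symbol at least
`1 - 2ε - 2α > 0` at every time (`le_transfer_full`). Cesàro limits along this trajectory give a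
stationary measure of positive magnetization. By the global flip, the all-minus past gives one of
negative magnetization. Since the kernel is continuous, stationary measures are compatible with it
(`isGMeasure_of_stationary`).

The bound comes from an induction over scales. In model `k` the scales up to `k` vote by majority,
while the whole tail of the weights always votes `+1`; model `0` is a coin of mean `1 - 2ε`. Passing
to model `k + 1` changes the dynamics only where the majority over `m (k + 1)` symbols is negative.
The effect of such a defect on later means is summable, because a chain of range `m k` forgets its
past geometrically (`sum_oscillation_symbol_le`). So the loss is at most the probability of a defect
times a constant depending on `m k`.

Defects are rare even if the scales `r (k + 1) + 1, …, k + 1` always vote `-1`: a positive bias, the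
gap, survives, and the chain so obtained has range only `m (r (k + 1))`. Symmetry bounds its mean
below by `(1 - 2ε)` times the gap, and a Hoeffding–Azuma argument bounds its fluctuations. The
constant `A_k` makes the loss at step `k` at most `α / 2 ^ k`, for a total of at most `2α`.
Monotonicity of the transfer operators plays the role of couplings throughout. -/

/-- The transfer operator of the chain which, given the past `x`, draws `+1` with
probability `u x` and `-1` otherwise. -/
noncomputable def transfer (u : Past ℤˣ → ℝ) : Module.End ℝ (Past ℤˣ → ℝ) where
  toFun f x := u x * f (Past.cons 1 x) + (1 - u x) * f (Past.cons (-1) x)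
  map_add' f g := by ext x; simp only [Pi.add_apply]; ring
  map_smul' c f := by ext x; simp only [Pi.smul_apply, smul_eq_mul, RingHom.id_apply]; ring

theorem transfer_apply (u f : Past ℤˣ → ℝ) (x : Past ℤˣ) :
    transfer u f x = u x * f (Past.cons 1 x) + (1 - u x) * f (Past.cons (-1) x) := rfl

/-- `u` is a probability for every past, and it is monotone in the past. -/
structure IsAttractive (u : Past ℤˣ → ℝ) : Prop where
  mono : Monotone u
  nonneg : ∀ x, 0 ≤ u x
  le_one : ∀ x, u x ≤ 1

theorem cons_le_cons {a b : ℤˣ} (hab : a ≤ b) {x y : Past ℤˣ} (h : x ≤ y) :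
    Past.cons a x ≤ Past.cons b y
  | 0 => hab
  | n + 1 => h n

theorem units_le_one (a : ℤˣ) : a ≤ 1 := by
  rcases Int.units_eq_one_or a with rfl | rfl <;> decide

theorem neg_one_le_units (a : ℤˣ) : -1 ≤ a := by
  rcases Int.units_eq_one_or a with rfl | rfl <;> decide

theorem past_le_one (x : Past ℤˣ) : x ≤ 1 := fun n => units_le_one (x n)

theorem neg_one_le_past (x : Past ℤˣ) : -1 ≤ x := fun n => neg_one_le_units (x n)

theorem neg_cons (a : ℤˣ) (x : Past ℤˣ) : -Past.cons a x = Past.cons (-a) (-x) := by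
  funext n; cases n <;> rfl

/-! ### Positivity, attractiveness and comparison of transfer operators -/

section Order

variable {u v f g : Past ℤˣ → ℝ}

theorem transfer_nonneg (h0 : ∀ x, 0 ≤ u x) (h1 : ∀ x, u x ≤ 1) (hf : 0 ≤ f) :
    0 ≤ transfer u f := fun x =>
  add_nonneg (mul_nonneg (h0 x) (hf _)) (mul_nonneg (sub_nonneg.2 (h1 x)) (hf _))

theorem transfer_mono (h0 : ∀ x, 0 ≤ u x) (h1 : ∀ x, u x ≤ 1) (hfg : f ≤ g) :
    transfer u f ≤ transfer u g := by
  have := transfer_nonneg h0 h1 (sub_nonneg.2 hfg)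
  rwa [map_sub, sub_nonneg] at this

theorem transfer_pow_mono (h0 : ∀ x, 0 ≤ u x) (h1 : ∀ x, u x ≤ 1) (hfg : f ≤ g) (n : ℕ) :
    (transfer u ^ n) f ≤ (transfer u ^ n) g := by
  induction n with
  | zero => simpa using hfg
  | succ n ih =>
    rw [pow_succ', Module.End.mul_apply, Module.End.mul_apply]
    exact transfer_mono h0 h1 ih

theorem transfer_const (u : Past ℤˣ → ℝ) (c : ℝ) :
    transfer u (fun _ => c) = fun _ => c := by
  funext x; rw [transfer_apply]; ring

theorem transfer_pow_const (u : Past ℤˣ → ℝ) (c : ℝ) (n : ℕ) :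
    (transfer u ^ n) (fun _ => c) = fun _ => c := by
  induction n with
  | zero => rfl
  | succ n ih => rw [pow_succ', Module.End.mul_apply, ih, transfer_const]

theorem transfer_pow_le (h0 : ∀ x, 0 ≤ u x) (h1 : ∀ x, u x ≤ 1) {c : ℝ} (hf : ∀ x, f x ≤ c)
    (n : ℕ) (x : Past ℤˣ) : (transfer u ^ n) f x ≤ c := by
  have := transfer_pow_mono h0 h1 (g := fun _ => c) hf n x
  rwa [transfer_pow_const] at this

theorem le_transfer_pow (h0 : ∀ x, 0 ≤ u x) (h1 : ∀ x, u x ≤ 1) {c : ℝ} (hf : ∀ x, c ≤ f x)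
    (n : ℕ) (x : Past ℤˣ) : c ≤ (transfer u ^ n) f x := by
  have := transfer_pow_mono h0 h1 (f := fun _ => c) hf n x
  rwa [transfer_pow_const] at this

/-- Raising the past raises both possible outcomes, and it also moves mass from the lower outcome to
the higher one. -/
theorem IsAttractive.monotone_transfer (hu : IsAttractive u) (hf : Monotone f) :
    Monotone (transfer u f) := by
  intro x y hxy
  rw [transfer_apply, transfer_apply]
  have h1 := hf (cons_le_cons (le_refl (1 : ℤˣ)) hxy)
  have h2 := hf (cons_le_cons (le_refl (-1 : ℤˣ)) hxy)
  have h3 := hf (cons_le_cons (units_le_one (-1)) (le_refl y))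
  nlinarith [mul_nonneg (hu.nonneg x) (sub_nonneg.2 h1),
    mul_nonneg (sub_nonneg.2 (hu.le_one x)) (sub_nonneg.2 h2),
    mul_nonneg (sub_nonneg.2 (hu.mono hxy)) (sub_nonneg.2 h3)]

theorem IsAttractive.monotone_transfer_pow (hu : IsAttractive u) (hf : Monotone f) (n : ℕ) :
    Monotone ((transfer u ^ n) f) := by
  induction n with
  | zero => simpa using hf
  | succ n ih =>
    rw [pow_succ', Module.End.mul_apply]
    exact hu.monotone_transfer ih

theorem transfer_le_transfer (huv : u ≤ v) (hf : Monotone f) :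
    transfer u f ≤ transfer v f := by
  intro x
  rw [transfer_apply, transfer_apply]
  have h3 := hf (cons_le_cons (units_le_one (-1)) (le_refl x))
  nlinarith [mul_nonneg (sub_nonneg.2 (huv x)) (sub_nonneg.2 h3)]

theorem IsAttractive.transfer_pow_le_transfer_pow (hu : IsAttractive u) (hv : IsAttractive v)
    (huv : u ≤ v) (hf : Monotone f) (n : ℕ) :
    (transfer u ^ n) f ≤ (transfer v ^ n) f := by
  induction n with
  | zero => simp
  | succ n ih =>
    rw [pow_succ', pow_succ', Module.End.mul_apply, Module.End.mul_apply]
    exact (transfer_mono hu.nonneg hu.le_one ih).trans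
      (transfer_le_transfer huv (hv.monotone_transfer_pow hf n))

theorem transfer_odd (hu : ∀ x, u (-x) = 1 - u x) (hf : ∀ x, f (-x) = -f x) (x : Past ℤˣ) :
    transfer u f (-x) = -transfer u f x := by
  have h1 : Past.cons 1 (-x) = -Past.cons (-1) x := by rw [neg_cons, neg_neg]
  have h2 : Past.cons (-1) (-x) = -Past.cons 1 x := by rw [neg_cons]
  rw [transfer_apply, transfer_apply, h1, h2, hf, hf, hu]
  ring

theorem transfer_pow_odd (hu : ∀ x, u (-x) = 1 - u x) (hf : ∀ x, f (-x) = -f x) (n : ℕ)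
    (x : Past ℤˣ) : (transfer u ^ n) f (-x) = -(transfer u ^ n) f x := by
  induction n generalizing x with
  | zero => simpa using hf x
  | succ n ih =>
    rw [pow_succ', Module.End.mul_apply]
    exact transfer_odd hu ih x

/-- Each step costs at most `η` times the oscillation `2` of the observable. The bound grows with
`n`, so it serves only to pass from truncated models to the full one at a fixed time. -/
theorem abs_transfer_pow_sub_le (hu0 : ∀ x, 0 ≤ u x) (hu1 : ∀ x, u x ≤ 1)
    (hv0 : ∀ x, 0 ≤ v x) (hv1 : ∀ x, v x ≤ 1) {η : ℝ} (huv : ∀ x, |u x - v x| ≤ η)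
    (hf : ∀ x, |f x| ≤ 1) (n : ℕ) (x : Past ℤˣ) :
    |(transfer u ^ n) f x - (transfer v ^ n) f x| ≤ n * (2 * η) := by
  induction n generalizing x with
  | zero => simp
  | succ n ih =>
    have hb : ∀ y, |(transfer v ^ n) f y| ≤ 1 := fun y => abs_le.2
      ⟨le_transfer_pow hv0 hv1 (fun z => (abs_le.1 (hf z)).1) n y,
        transfer_pow_le hv0 hv1 (fun z => (abs_le.1 (hf z)).2) n y⟩
    rw [pow_succ', pow_succ', Module.End.mul_apply, Module.End.mul_apply, transfer_apply,
      transfer_apply]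
    set F := (transfer u ^ n) f
    set G := (transfer v ^ n) f
    have e : u x * F (Past.cons 1 x) + (1 - u x) * F (Past.cons (-1) x) -
        (v x * G (Past.cons 1 x) + (1 - v x) * G (Past.cons (-1) x)) =
        (u x * (F (Past.cons 1 x) - G (Past.cons 1 x)) +
          (1 - u x) * (F (Past.cons (-1) x) - G (Past.cons (-1) x))) +
        (u x - v x) * (G (Past.cons 1 x) - G (Past.cons (-1) x)) := by ring
    rw [e]
    have h1 := abs_le.1 (ih (Past.cons 1 x))
    have h2 := abs_le.1 (ih (Past.cons (-1) x))
    have hA : |u x * (F (Past.cons 1 x) - G (Past.cons 1 x)) +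
          (1 - u x) * (F (Past.cons (-1) x) - G (Past.cons (-1) x))| ≤ n * (2 * η) := by
      have := hu0 x
      have := hu1 x
      rw [abs_le]
      constructor <;> nlinarith
    have hB : |(u x - v x) * (G (Past.cons 1 x) - G (Past.cons (-1) x))| ≤ η * 2 := by
      rw [abs_mul]
      refine mul_le_mul (huv x) ?_ (abs_nonneg _) ((abs_nonneg _).trans (huv x))
      have := abs_le.1 (hb (Past.cons 1 x))
      have := abs_le.1 (hb (Past.cons (-1) x))
      rw [abs_le]
      constructor <;> linarith
    refine (abs_add_le _ _).trans ?_
    push_cast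
    linarith

end Order

/-! ### Loss of memory for chains of finite range -/

section Contraction

variable {u f : Past ℤˣ → ℝ}

theorem dependsOn_transfer {m : ℕ} (hu : DependsOn u (Set.Iio m))
    (hf : DependsOn f (Set.Iio (m + 1))) : DependsOn (transfer u f) (Set.Iio m) := by
  intro x y hxy
  have h : ∀ a : ℤˣ, f (Past.cons a x) = f (Past.cons a y) := fun a => hf fun i hi => by
    cases i with
    | zero => rfl
    | succ i => exact hxy i (Nat.lt_of_succ_lt_succ hi)
  rw [transfer_apply, transfer_apply, h, h, hu hxy]

theorem dependsOn_transfer_pow {m : ℕ} (hu : DependsOn u (Set.Iio m))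
    (hf : DependsOn f (Set.Iio m)) (n : ℕ) : DependsOn ((transfer u ^ n) f) (Set.Iio m) := by
  induction n with
  | zero => simpa using hf
  | succ n ih =>
    rw [pow_succ', Module.End.mul_apply]
    exact dependsOn_transfer hu (ih.mono (Set.Iio_subset_Iio (Nat.le_succ m)))

theorem transfer_pow_eq_of_dependsOn (p : ℝ) {m : ℕ} (hf : DependsOn f (Set.Iio m))
    (x y : Past ℤˣ) : (transfer (fun _ => p) ^ m) f x = (transfer (fun _ => p) ^ m) f y := by
  induction m generalizing f with
  | zero => exact hf fun i hi => absurd hi (Nat.not_lt_zero i)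
  | succ m ih =>
    rw [pow_succ, Module.End.mul_apply]
    exact ih (dependsOn_transfer (fun _ _ _ => rfl) hf)

/-- Both symbols have probability at least `ε = 2ε · (1/2)`, so each step dominates `2ε` times a
fair coin toss. -/
theorem minorization {ε : ℝ} (hε : 0 ≤ ε) (h0 : ∀ x, ε ≤ u x) (h1 : ∀ x, u x ≤ 1 - ε)
    (hf : 0 ≤ f) (n : ℕ) :
    (2 * ε) ^ n • (transfer (fun _ => 1 / 2) ^ n) f ≤ (transfer u ^ n) f := by
  have hu0 : ∀ x, 0 ≤ u x := fun x => hε.trans (h0 x)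
  have hu1 : ∀ x, u x ≤ 1 := fun x => (h1 x).trans (by linarith)
  induction n with
  | zero => simp
  | succ n ih =>
    have hp : 0 ≤ (transfer (fun _ => 1 / 2) ^ n) f := fun x =>
      le_transfer_pow (fun _ => by norm_num) (fun _ => by norm_num) hf n x
    rw [pow_succ' (transfer u), Module.End.mul_apply]
    refine le_trans ?_ (transfer_mono hu0 hu1 ih)
    rw [map_smul, pow_succ, mul_smul, pow_succ' (transfer _), Module.End.mul_apply]
    refine smul_le_smul_of_nonneg_left ?_ (by positivity)
    intro x
    rw [Pi.smul_apply, transfer_apply, transfer_apply, smul_eq_mul]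
    have a := hp (Past.cons 1 x)
    have b := hp (Past.cons (-1) x)
    simp only [Pi.zero_apply] at a b
    nlinarith [mul_nonneg a (sub_nonneg.2 (h0 x)), mul_nonneg b (sub_nonneg.2 (h1 x))]

/-- Doeblin's argument: `m` fair tosses erase the whole window seen by `f`, so the two extreme pasts
share a common part of mass `(2ε)^m`. -/
theorem oscillation_contraction {ε : ℝ} (hε : 0 ≤ ε) (h0 : ∀ x, ε ≤ u x)
    (h1 : ∀ x, u x ≤ 1 - ε) {m : ℕ} (hf : DependsOn f (Set.Iio m)) (hmono : Monotone f) :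
    (transfer u ^ m) f 1 - (transfer u ^ m) f (-1) ≤
      (1 - (2 * ε) ^ m) * (f 1 - f (-1)) := by
  have hlow := minorization hε h0 h1 (f := f - fun _ => f (-1))
    (fun x => sub_nonneg.2 (hmono (neg_one_le_past x))) m (-1)
  have hupp := minorization hε h0 h1 (f := (fun _ => f 1) - f)
    (fun x => sub_nonneg.2 (hmono (past_le_one x))) m 1
  simp only [map_sub, transfer_pow_const, Pi.smul_apply, Pi.sub_apply, smul_eq_mul] at hlow hupp
  rw [transfer_pow_eq_of_dependsOn _ hf (-1) 1] at hlow
  nlinarith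

/-- With `S` the partial sum, splitting off the first `m` terms gives `S ≤ m * d 0 + (1 - κ) * S`.
-/
theorem sum_range_le_of_contraction {d : ℕ → ℝ} (hd : Antitone d) (hd0 : ∀ j, 0 ≤ d j)
    {κ : ℝ} (hκ : 0 < κ) {m : ℕ} (h : ∀ j, d (m + j) ≤ (1 - κ) * d j) (n : ℕ) :
    ∑ j ∈ Finset.range n, d j ≤ m * κ⁻¹ * d 0 := by
  have e1 : ∑ j ∈ Finset.range n, d (m + j) ≤ (1 - κ) * ∑ j ∈ Finset.range n, d j := by
    rw [Finset.mul_sum]; exact Finset.sum_le_sum fun j _ => h j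
  have e2 : ∑ j ∈ Finset.range n, d j ≤ ∑ j ∈ Finset.range (m + n), d j :=
    Finset.sum_le_sum_of_subset_of_nonneg (Finset.range_mono (Nat.le_add_left n m))
      fun j _ _ => hd0 j
  rw [Finset.sum_range_add] at e2
  have e3 : ∑ j ∈ Finset.range m, d j ≤ m * d 0 := by
    calc _ ≤ ∑ j ∈ Finset.range m, d 0 := Finset.sum_le_sum fun j _ => hd (Nat.zero_le j)
      _ = m * d 0 := by simp
  have e4 : κ * ∑ j ∈ Finset.range n, d j ≤ m * d 0 := by linarith
  calc _ = κ⁻¹ * (κ * ∑ j ∈ Finset.range n, d j) := by field_simp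
    _ ≤ κ⁻¹ * (m * d 0) := by gcongr
    _ = _ := by ring

theorem sum_oscillation_le {ε : ℝ} (hε : 0 < ε) (hu : Monotone u) (h0 : ∀ x, ε ≤ u x)
    (h1 : ∀ x, u x ≤ 1 - ε) {m : ℕ} (hdep : DependsOn u (Set.Iio m))
    (hf : DependsOn f (Set.Iio m)) (hmono : Monotone f) (n : ℕ) :
    ∑ j ∈ Finset.range n, ((transfer u ^ j) f 1 - (transfer u ^ j) f (-1)) ≤
      m * (2 * ε) ^ (-(m : ℤ)) * (f 1 - f (-1)) := by
  have hatt : IsAttractive u :=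
    ⟨hu, fun x => hε.le.trans (h0 x), fun x => (h1 x).trans (by linarith)⟩
  have hm := fun j => hatt.monotone_transfer_pow hmono j
  have := sum_range_le_of_contraction
    (d := fun j => (transfer u ^ j) f 1 - (transfer u ^ j) f (-1)) (κ := (2 * ε) ^ m) (m := m)
    ?_ ?_ (by positivity) ?_ n
  · simpa [zpow_neg] using this
  · refine antitone_nat_of_succ_le fun j => ?_
    simp only [pow_succ', Module.End.mul_apply]
    have a := transfer_pow_le hatt.nonneg hatt.le_one (fun x => hm j (past_le_one x)) 1 1
    have b := le_transfer_pow hatt.nonneg hatt.le_one (fun x => hm j (neg_one_le_past x)) 1 (-1)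
    rw [pow_one] at a b
    linarith
  · exact fun j => sub_nonneg.2 (hm j (neg_one_le_past 1))
  · intro j
    simp only [pow_add, Module.End.mul_apply]
    exact oscillation_contraction hε.le h0 h1 (dependsOn_transfer_pow hdep hf j) (hm j)

end Contraction

/-! ### Symbols, magnetization and exponential concentration -/

/-- The current symbol, as a real number. -/
def symbol (x : Past ℤˣ) : ℝ := ((x 0 : ℤ) : ℝ)

theorem symbol_cons (a : ℤˣ) (x : Past ℤˣ) : symbol (Past.cons a x) = ((a : ℤ) : ℝ) := rfl

theorem symbol_monotone : Monotone symbol := fun _ _ h => Int.cast_le.2 (h 0)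

theorem symbol_neg (x : Past ℤˣ) : symbol (-x) = -symbol x := by simp [symbol]

theorem symbol_one : symbol 1 = 1 := by simp [symbol]

theorem abs_symbol (x : Past ℤˣ) : |symbol x| = 1 := by
  rcases Int.units_eq_one_or (x 0) with h | h <;> simp [symbol, h]

theorem transfer_symbol (u : Past ℤˣ → ℝ) (x : Past ℤˣ) :
    transfer u symbol x = 2 * u x - 1 := by
  rw [transfer_apply, symbol_cons, symbol_cons]; push_cast; ring

theorem dependsOn_symbol : DependsOn symbol (Set.Iio 1) := fun x y h => by
  rw [symbol, symbol, h 0 (by simp)]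

theorem sum_oscillation_transfer_symbol_le {u : Past ℤˣ → ℝ} {ε : ℝ} (hε : 0 < ε)
    (hu : Monotone u) (h0 : ∀ x, ε ≤ u x) (h1 : ∀ x, u x ≤ 1 - ε) {m : ℕ}
    (hdep : DependsOn u (Set.Iio m)) (n : ℕ) :
    ∑ j ∈ Finset.range n,
        ((transfer u ^ (j + 1)) symbol 1 - (transfer u ^ (j + 1)) symbol (-1)) ≤
      2 * (m * (2 * ε) ^ (-(m : ℤ))) := by
  have hatt : IsAttractive u :=
    ⟨hu, fun x => hε.le.trans (h0 x), fun x => (h1 x).trans (by linarith)⟩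
  have := sum_oscillation_le hε hu h0 h1 hdep (f := transfer u symbol)
    (dependsOn_transfer hdep (dependsOn_symbol.mono
      (Set.Iio_subset_Iio (Nat.succ_le_succ (Nat.zero_le m)))))
    (hatt.monotone_transfer symbol_monotone) n
  simp only [← Module.End.mul_apply, ← pow_succ] at this
  refine this.trans ?_
  rw [transfer_symbol, transfer_symbol]
  have : 0 ≤ m * (2 * ε) ^ (-(m : ℤ)) := by positivity
  nlinarith [hatt.nonneg (-1), hatt.le_one 1]

theorem sum_oscillation_symbol_le {u : Past ℤˣ → ℝ} {ε : ℝ} (hε : 0 < ε)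
    (hu : Monotone u) (h0 : ∀ x, ε ≤ u x) (h1 : ∀ x, u x ≤ 1 - ε) {m : ℕ}
    (hdep : DependsOn u (Set.Iio m)) (n : ℕ) :
    ∑ j ∈ Finset.range n, ((transfer u ^ j) symbol 1 - (transfer u ^ j) symbol (-1)) ≤
      2 * (1 + m * (2 * ε) ^ (-(m : ℤ))) := by
  have hpos : 0 ≤ m * (2 * ε) ^ (-(m : ℤ)) := by positivity
  cases n with
  | zero => simp only [Finset.range_zero, Finset.sum_empty]; positivity
  | succ n =>
    -- The term of time `0` is set apart because `symbol` looks at one coordinate even when `m = 0`.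
    -- It contributes `2`, whence the `1 +` in the bound.
    rw [Finset.sum_range_succ']
    have := sum_oscillation_transfer_symbol_le hε hu h0 h1 hdep n
    simp only [pow_zero, Module.End.one_apply, symbol_neg, symbol_one]
    linarith

/-- Hoeffding's lemma for a two-point law, with a constant weaker than the optimal one. -/
theorem two_point_exp_le {p a b c : ℝ} (h0 : 0 ≤ p) (h1 : p ≤ 1) (hab : |a - b| ≤ c) :
    p * Real.exp a + (1 - p) * Real.exp b ≤ Real.exp (c ^ 2 / 2 + (p * a + (1 - p) * b)) := by
  rcases eq_or_lt_of_le ((abs_nonneg _).trans hab) with hc | hc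
  · have : a = b := by
      have : |a - b| ≤ 0 := hc ▸ hab
      linarith [abs_nonpos_iff.1 this]
    subst this
    have : p * a + (1 - p) * a = a := by ring
    rw [← hc, this]
    simp only [ne_eq, OfNat.ofNat_ne_zero, not_false_eq_true, zero_pow, zero_div, zero_add]
    linarith
  -- The chord of `exp` over `[-c, c]` lies above it. After centering, its linear part averages to
  -- zero and leaves `cosh c`.
  · have key : ∀ D : ℝ, |D| ≤ c → Real.exp D ≤ Real.cosh c + D * (Real.sinh c / c) := by
      intro D hD
      obtain ⟨l, h⟩ := abs_le.1 hD
      have ha : 0 ≤ (c + D) / (2 * c) := div_nonneg (by linarith) (by linarith)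
      have hb : 0 ≤ (c - D) / (2 * c) := div_nonneg (by linarith) (by linarith)
      have := convexOn_exp.2 (Set.mem_univ c) (Set.mem_univ (-c)) ha hb
        (by field_simp; ring)
      have e : ((c + D) / (2 * c)) • c + ((c - D) / (2 * c)) • (-c) = D := by
        simp only [smul_eq_mul]; field_simp; ring
      rw [e] at this
      refine this.trans (le_of_eq ?_)
      rw [Real.cosh_eq, Real.sinh_eq, smul_eq_mul, smul_eq_mul]
      field_simp
      ring
    obtain ⟨hl, hr⟩ := abs_le.1 hab
    have ka := key ((1 - p) * (a - b)) (by rw [abs_le]; constructor <;> nlinarith)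
    have kb := key (-p * (a - b)) (by rw [abs_le]; constructor <;> nlinarith)
    have hcosh : p * Real.exp ((1 - p) * (a - b)) + (1 - p) * Real.exp (-p * (a - b)) ≤
        Real.exp (c ^ 2 / 2) := by
      refine le_trans ?_ (Real.cosh_le_exp_half_sq c)
      have h1p : 0 ≤ 1 - p := by linarith
      calc _ ≤ p * (Real.cosh c + (1 - p) * (a - b) * (Real.sinh c / c)) +
            (1 - p) * (Real.cosh c + -p * (a - b) * (Real.sinh c / c)) := by gcongr
        _ = Real.cosh c := by ring
    rw [Real.exp_add]
    refine le_trans (le_of_eq ?_)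
      (mul_le_mul_of_nonneg_right hcosh (Real.exp_pos (p * a + (1 - p) * b)).le)
    rw [add_mul, mul_assoc, mul_assoc, ← Real.exp_add, ← Real.exp_add]
    ring_nf

/-- The sum of the `n` most recent symbols. -/
def magnetization (n : ℕ) (x : Past ℤˣ) : ℝ := ∑ l ∈ Finset.range n, ((x l : ℤ) : ℝ)

theorem magnetization_succ_cons (n : ℕ) (a : ℤˣ) (x : Past ℤˣ) :
    magnetization (n + 1) (Past.cons a x) = ((a : ℤ) : ℝ) + magnetization n x := by
  rw [magnetization, Finset.sum_range_succ', add_comm]; rfl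

theorem magnetization_monotone (n : ℕ) : Monotone (magnetization n) := fun _ _ h =>
  Finset.sum_le_sum fun l _ => Int.cast_le.2 (h l)

section Concentration

variable {u : Past ℤˣ → ℝ}

/-- Azuma's inequality by conditioning on the first new symbol: the martingale increment is the
change in the expected future sum, at most `2 * B`, and costs `(2 * B * θ)^2 / 2` in the exponent.
-/
theorem transfer_pow_exp_magnetization_le (h0 : ∀ x, 0 ≤ u x) (h1 : ∀ x, u x ≤ 1) {B : ℝ}
    (hosc : ∀ n x y,
      |∑ j ∈ Finset.range n, ((transfer u ^ j) symbol x - (transfer u ^ j) symbol y)| ≤ 2 * B)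
    {θ : ℝ} (hθ : 0 ≤ θ) (j n : ℕ) (x : Past ℤˣ) :
    (transfer u ^ j) (fun y => Real.exp (-θ * magnetization (n + j) y)) x ≤
      Real.exp (2 * B ^ 2 * θ ^ 2 * j - θ * (magnetization n x +
        ∑ s ∈ Finset.range j, (transfer u ^ (s + 1)) symbol x)) := by
  induction j generalizing n x with
  | zero => simp
  | succ j ih =>
    rw [pow_succ', Module.End.mul_apply]
    have hle : (transfer u ^ j) (fun y => Real.exp (-θ * magnetization (n + (j + 1)) y)) ≤
        fun x => Real.exp (2 * B ^ 2 * θ ^ 2 * j - θ * (magnetization (n + 1) x +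
        ∑ s ∈ Finset.range j, (transfer u ^ (s + 1)) symbol x)) := fun x => by
      have := ih (n + 1) x
      rwa [show n + 1 + j = n + (j + 1) by ring] at this
    refine (transfer_mono h0 h1 hle x).trans ?_
    -- `φ a` is the expected sum of the next `j + 1` symbols when the first of them is `a`.
    set φ : ℤˣ → ℝ := fun a =>
      ∑ s ∈ Finset.range (j + 1), (transfer u ^ s) symbol (Past.cons a x) with hφ
    have hexp : ∀ a : ℤˣ, Real.exp (2 * B ^ 2 * θ ^ 2 * j -
        θ * (magnetization (n + 1) (Past.cons a x) +
          ∑ s ∈ Finset.range j, (transfer u ^ (s + 1)) symbol (Past.cons a x))) =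
        Real.exp (2 * B ^ 2 * θ ^ 2 * j - θ * magnetization n x) * Real.exp (-θ * φ a) := by
      intro a
      rw [← Real.exp_add, hφ, magnetization_succ_cons]
      simp only [Finset.sum_range_succ' _ j, pow_zero, Module.End.one_apply, symbol_cons]
      ring_nf
    have hmean : ∑ s ∈ Finset.range (j + 1), (transfer u ^ (s + 1)) symbol x =
        u x * φ 1 + (1 - u x) * φ (-1) := by
      simp only [hφ, Finset.mul_sum, ← Finset.sum_add_distrib]
      refine Finset.sum_congr rfl fun s _ => ?_
      rw [pow_succ', Module.End.mul_apply, transfer_apply]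
    rw [transfer_apply, hexp, hexp, hmean]
    have hdiff : |(-θ * φ 1) - (-θ * φ (-1))| ≤ θ * (2 * B) := by
      have : (-θ * φ 1) - (-θ * φ (-1)) = -(θ * (φ 1 - φ (-1))) := by ring
      rw [this, abs_neg, abs_mul, abs_of_nonneg hθ, hφ]
      simp only [← Finset.sum_sub_distrib]
      exact mul_le_mul_of_nonneg_left (hosc _ _ _) hθ
    have := two_point_exp_le (h0 x) (h1 x) hdiff
    calc _ = Real.exp (2 * B ^ 2 * θ ^ 2 * j - θ * magnetization n x) *
          (u x * Real.exp (-θ * φ 1) + (1 - u x) * Real.exp (-θ * φ (-1))) := by ring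
      _ ≤ Real.exp (2 * B ^ 2 * θ ^ 2 * j - θ * magnetization n x) * _ :=
          mul_le_mul_of_nonneg_left this (Real.exp_pos _).le
      _ = _ := by
          rw [← Real.exp_add]
          push_cast
          ring_nf

theorem IsAttractive.transfer_pow_exp_magnetization_le_uniform (hu : IsAttractive u) {B D : ℝ}
    (hB : ∀ n,
      ∑ j ∈ Finset.range n, ((transfer u ^ j) symbol 1 - (transfer u ^ j) symbol (-1)) ≤ 2 * B)
    (hB' : ∀ n, ∑ j ∈ Finset.range n,
      ((transfer u ^ (j + 1)) symbol 1 - (transfer u ^ (j + 1)) symbol (-1)) ≤ 2 * B)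
    (hD : ∀ n, D ≤ (transfer u ^ (n + 1)) symbol 1)
    {θ : ℝ} (hθ : 0 ≤ θ) (N i : ℕ) :
    (transfer u ^ i) (fun y => Real.exp (-θ * magnetization N y)) 1 ≤
      Real.exp (2 * B ^ 2 * θ ^ 2 * N - θ * (N * D - 2 * B)) := by
  have hm := fun j => hu.monotone_transfer_pow symbol_monotone j
  set F : Past ℤˣ → ℝ := fun y => Real.exp (-θ * magnetization N y) with hF
  have hanti : Monotone (-F) := fun x y h => neg_le_neg (Real.exp_le_exp.2 (by
    nlinarith [magnetization_monotone N h]))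
  have hN : ∀ x, (transfer u ^ N) F x ≤
      Real.exp (2 * B ^ 2 * θ ^ 2 * N - θ * (N * D - 2 * B)) := by
    intro x
    have hosc : ∀ n x y,
        |∑ j ∈ Finset.range n, ((transfer u ^ j) symbol x - (transfer u ^ j) symbol y)| ≤
          2 * B := by
      intro n x y
      rw [abs_le, ← neg_le]
      constructor
      · rw [← Finset.sum_neg_distrib]
        refine le_trans (Finset.sum_le_sum fun j _ => ?_) (hB n)
        linarith [hm j (neg_one_le_past x), hm j (past_le_one y)]
      · refine le_trans (Finset.sum_le_sum fun j _ => ?_) (hB n)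
        linarith [hm j (neg_one_le_past y), hm j (past_le_one x)]
    have := transfer_pow_exp_magnetization_le hu.nonneg hu.le_one hosc hθ N 0 x
    rw [zero_add] at this
    refine this.trans (Real.exp_le_exp.2 ?_)
    have hlow : N * D - 2 * B ≤
        ∑ s ∈ Finset.range N, (transfer u ^ (s + 1)) symbol x := by
      have e1 : N * D ≤ ∑ s ∈ Finset.range N, (transfer u ^ (s + 1)) symbol 1 := by
        calc N * D = ∑ s ∈ Finset.range N, D := by simp
          _ ≤ _ := Finset.sum_le_sum fun s _ => hD s
      have e2 := hB' N
      rw [Finset.sum_sub_distrib] at e2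
      have e3 : ∑ s ∈ Finset.range N, (transfer u ^ (s + 1)) symbol (-1) ≤
          ∑ s ∈ Finset.range N, (transfer u ^ (s + 1)) symbol x :=
        Finset.sum_le_sum fun s _ => hm (s + 1) (neg_one_le_past x)
      linarith
    have e0 : magnetization 0 x = 0 := by simp [magnetization]
    rw [e0, zero_add]
    linarith [mul_le_mul_of_nonneg_left hlow hθ]
  -- As `F` is antitone, the all-plus past minimizes its expectation. Running `N` extra steps
  -- therefore only increases it, and the window then contains new symbols only, so the estimate
  -- holds even for `i < N`.
  have hi : ∀ x, (transfer u ^ i) F 1 ≤ (transfer u ^ i) F x := fun x => by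
    have := hu.monotone_transfer_pow hanti i (past_le_one x)
    simp only [map_neg, Pi.neg_apply] at this
    linarith
  calc (transfer u ^ i) F 1 ≤ (transfer u ^ N) ((transfer u ^ i) F) 1 :=
        le_transfer_pow hu.nonneg hu.le_one hi N 1
    _ = (transfer u ^ i) ((transfer u ^ N) F) 1 := by
        rw [← Module.End.mul_apply, ← Module.End.mul_apply, ← pow_add, ← pow_add, add_comm]
    _ ≤ _ := transfer_pow_le hu.nonneg hu.le_one hN i 1

end Concentration

/-! ### Perturbation of the dynamics on a rare event -/

/-- The value at the all-plus past is stable when `u` is lowered to `v` on an event which the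
chain of `v` started from the all-plus past rarely sees. -/
theorem IsAttractive.transfer_pow_le_transfer_pow_add {u v F f : Past ℤˣ → ℝ}
    (hu : IsAttractive u) (hv : IsAttractive v) (hf : Monotone f) (hF : 0 ≤ F)
    (huv : ∀ x, u x - v x ≤ F x) {P : ℝ} (hP : ∀ i, (transfer v ^ i) F 1 ≤ P) (i j : ℕ) :
    (transfer v ^ i) ((transfer u ^ j) f) 1 ≤ (transfer v ^ (i + j)) f 1 +
      P * ∑ l ∈ Finset.range j, ((transfer u ^ l) f 1 - (transfer u ^ l) f (-1)) := by
  induction j generalizing i with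
  | zero => simp
  | succ j ih =>
    set g := (transfer u ^ j) f with hg
    have hgm : Monotone g := hu.monotone_transfer_pow hf j
    have hd : 0 ≤ g 1 - g (-1) := sub_nonneg.2 (hgm (neg_one_le_past 1))
    -- One step of a Duhamel expansion: replacing `u` by `v` costs at most `F` times the full
    -- oscillation of `g`.
    have hstep : transfer u g ≤ transfer v g + (g 1 - g (-1)) • F := by
      intro x
      rw [Pi.add_apply, Pi.smul_apply, transfer_apply, transfer_apply, smul_eq_mul]
      have a := hgm (past_le_one (Past.cons 1 x))
      have b := hgm (neg_one_le_past (Past.cons (-1) x))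
      have c := hgm (cons_le_cons (units_le_one (-1)) (le_refl x))
      have e : (u x - v x) * (g (Past.cons 1 x) - g (Past.cons (-1) x)) ≤
          F x * (g 1 - g (-1)) :=
        mul_le_mul (huv x) (by linarith) (by linarith) (hF x)
      linarith
    have h1 := transfer_pow_mono hv.nonneg hv.le_one hstep i 1
    rw [map_add, map_smul, Pi.add_apply, Pi.smul_apply, smul_eq_mul] at h1
    have h2 := ih (i + 1)
    rw [pow_succ, Module.End.mul_apply] at h2
    rw [pow_succ' (transfer u), Module.End.mul_apply, Finset.sum_range_succ, ← hg]
    rw [show i + 1 + j = i + (j + 1) by ring] at h2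
    nlinarith [mul_le_mul_of_nonneg_left (hP i) hd]

/-! ### Majority rules and truncated models -/

/-- The sign of the majority of the `n` most recent symbols. -/
def majority (n : ℕ) (x : Past ℤˣ) : ℝ :=
  ((∑ l ∈ Finset.range n, (x l : ℤ)).sign : ℤ)

theorem int_sign_monotone : Monotone Int.sign := fun a b h => by
  rcases lt_trichotomy a 0 with ha | ha | ha <;> rcases lt_trichotomy b 0 with hb | hb | hb <;>
    simp [ha, hb, Int.sign_eq_one_of_pos, Int.sign_eq_neg_one_of_neg] <;> omega

theorem majority_monotone (n : ℕ) : Monotone (majority n) := fun x y h => by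
  have : ∑ l ∈ Finset.range n, (x l : ℤ) ≤ ∑ l ∈ Finset.range n, (y l : ℤ) :=
    Finset.sum_le_sum fun l _ => h l
  exact Int.cast_le.2 (int_sign_monotone this)

theorem majority_neg (n : ℕ) (x : Past ℤˣ) : majority n (-x) = -majority n x := by
  simp [majority, Finset.sum_neg_distrib, Int.sign_neg]

theorem abs_majority_le_one (n : ℕ) (x : Past ℤˣ) : |majority n x| ≤ 1 := by
  rw [majority]
  rcases Int.sign_trichotomy (∑ l ∈ Finset.range n, (x l : ℤ)) with h | h | h <;> simp [h]

theorem dependsOn_majority (n : ℕ) : DependsOn (majority n) (Set.Iio n) := fun x y h => by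
  rw [majority, majority, Finset.sum_congr rfl fun l hl => by rw [h l (Finset.mem_range.1 hl)]]

theorem one_sub_majority_le {θ : ℝ} (hθ : 0 ≤ θ) (n : ℕ) (x : Past ℤˣ) :
    1 - majority n x ≤ 2 * Real.exp (-θ * magnetization n x) := by
  have e : magnetization n x = ((∑ l ∈ Finset.range n, (x l : ℤ) : ℤ) : ℝ) := by
    simp [magnetization]
  rw [e, majority]
  rcases lt_or_ge 0 (∑ l ∈ Finset.range n, (x l : ℤ)) with h | h
  · rw [Int.sign_eq_one_of_pos h, Int.cast_one, sub_self]
    positivity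
  · have h1 := (abs_le.1 (abs_majority_le_one n x)).1
    rw [majority] at h1
    have h2 : 1 ≤ Real.exp (-θ * ((∑ l ∈ Finset.range n, (x l : ℤ) : ℤ) : ℝ)) := by
      rw [Real.one_le_exp_iff]
      have : ((∑ l ∈ Finset.range n, (x l : ℤ) : ℤ) : ℝ) ≤ 0 := by exact_mod_cast h
      nlinarith
    linarith

/-- Every symbol is odd, so the sum has the parity of `n`. Excluding ties makes the majority kernel
affine in `majority`. -/
theorem sum_units_ne_zero {n : ℕ} (hn : Odd n) (x : Past ℤˣ) :
    ∑ l ∈ Finset.range n, (x l : ℤ) ≠ 0 := by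
  have hodd : ∀ k : ℕ, ∑ l ∈ Finset.range k, (x l : ℤ) ≡ k [ZMOD 2] := by
    intro k
    induction k with
    | zero => rfl
    | succ k ih =>
      rw [Finset.sum_range_succ]
      push_cast
      refine ih.add ?_
      rcases Int.units_eq_one_or (x k) with h | h <;> rw [h] <;> rfl
  intro h
  have := hodd n
  rw [h] at this
  obtain ⟨t, rfl⟩ := hn
  have h2 : (0 : ℤ) % 2 = ((2 * t + 1 : ℕ) : ℤ) % 2 := this
  omega

theorem majorityKernel_cons (ε : ℝ) {n : ℕ} (hn : Odd n) (a : ℤˣ) (x : Past ℤˣ) :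
    majorityKernel ε n (Past.cons a x) =
      1 / 2 + (1 / 2 - ε) * (((a : ℤ) : ℝ) * majority n x) := by
  have hsum : ∑ l ∈ Finset.Icc 1 n, ((Past.cons a x l : ℤˣ) : ℤ) =
      ∑ l ∈ Finset.range n, (x l : ℤ) := by
    rw [Finset.range_eq_Ico]
    exact (Finset.sum_Ico_add' (fun l => ((Past.cons a x l : ℤˣ) : ℤ)) 0 n 1).symm
  have h0 := sum_units_ne_zero hn x
  rw [majorityKernel, hsum, majority]
  set s := ∑ l ∈ Finset.range n, (x l : ℤ)
  have ha : Past.cons a x 0 = a := rfl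
  rw [ha]
  rcases Int.units_eq_one_or a with rfl | rfl <;> rcases lt_or_gt_of_ne h0 with h | h
  all_goals
    simp [h, h.not_gt, Int.sign_eq_one_of_pos, Int.sign_eq_neg_one_of_neg]
    try ring

/-- The probability of `+1` given the past when only the scales `1, …, n` are kept and the
others are replaced by a constant bias `c`. -/
noncomputable def truncatedProb (ε : ℝ) (lam : ℕ → ℝ) (m : ℕ → ℕ) (n : ℕ) (c : ℝ)
    (x : Past ℤˣ) : ℝ :=
  1 / 2 + (1 / 2 - ε) * (∑ j ∈ Finset.Icc 1 n, lam j * majority (m j) x + c)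

/-- The probability of `+1` given the past in the Bramson–Kalikow model. -/
noncomputable def fullProb (ε : ℝ) (lam : ℕ → ℝ) (m : ℕ → ℕ) (x : Past ℤˣ) : ℝ :=
  1 / 2 + (1 / 2 - ε) * ∑' j : ℕ, lam (j + 1) * majority (m (j + 1)) x

section Truncated

variable {ε : ℝ} {lam : ℕ → ℝ} {m : ℕ → ℕ} {n : ℕ} {c : ℝ}

theorem monotone_sum_majority (hlam : ∀ j, 1 ≤ j → 0 < lam j) :
    Monotone fun x => ∑ j ∈ Finset.Icc 1 n, lam j * majority (m j) x := fun _ _ h =>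
  Finset.sum_le_sum fun j hj => mul_le_mul_of_nonneg_left (majority_monotone _ h)
    (hlam j (Finset.mem_Icc.1 hj).1).le

theorem truncatedProb_monotone (hε : ε < 1 / 2) (hlam : ∀ j, 1 ≤ j → 0 < lam j) :
    Monotone (truncatedProb ε lam m n c) := fun x y h => by
  have := monotone_sum_majority (m := m) (n := n) hlam h
  simp only at this
  unfold truncatedProb
  nlinarith

theorem abs_sum_majority_le (hlam : ∀ j, 1 ≤ j → 0 < lam j) (x : Past ℤˣ) :
    |∑ j ∈ Finset.Icc 1 n, lam j * majority (m j) x| ≤ ∑ j ∈ Finset.Icc 1 n, lam j := by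
  refine (Finset.abs_sum_le_sum_abs _ _).trans (Finset.sum_le_sum fun j hj => ?_)
  have hj := hlam j (Finset.mem_Icc.1 hj).1
  rw [abs_mul, abs_of_pos hj]
  nlinarith [abs_majority_le_one (m j) x]

theorem truncatedProb_mem (hε : ε < 1 / 2) (hlam : ∀ j, 1 ≤ j → 0 < lam j)
    (hc : ∑ j ∈ Finset.Icc 1 n, lam j + |c| ≤ 1) (x : Past ℤˣ) :
    ε ≤ truncatedProb ε lam m n c x ∧ truncatedProb ε lam m n c x ≤ 1 - ε := by
  have h1 := abs_le.1 (abs_sum_majority_le (m := m) (n := n) hlam x)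
  have h2 := abs_le.1 (le_refl |c|)
  unfold truncatedProb
  constructor <;> nlinarith

theorem isAttractive_truncatedProb (hε0 : 0 < ε) (hε : ε < 1 / 2)
    (hlam : ∀ j, 1 ≤ j → 0 < lam j) (hc : ∑ j ∈ Finset.Icc 1 n, lam j + |c| ≤ 1) :
    IsAttractive (truncatedProb ε lam m n c) where
  mono := truncatedProb_monotone hε hlam
  nonneg x := hε0.le.trans (truncatedProb_mem hε hlam hc x).1
  le_one x := (truncatedProb_mem hε hlam hc x).2.trans (by linarith)

theorem dependsOn_truncatedProb (hm : Monotone m) :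
    DependsOn (truncatedProb ε lam m n c) (Set.Iio (m n)) := fun x y h => by
  unfold truncatedProb
  rw [Finset.sum_congr rfl fun j hj => ?_]
  rw [dependsOn_majority (m j) fun i hi =>
    h i (lt_of_lt_of_le hi (hm (Finset.mem_Icc.1 hj).2))]

/-- The drift is `(1 - 2ε) * (G + c)` with `G` the weighted vote, so it is enough that `G` has
nonnegative mean from the all-plus past. -/
theorem le_transfer_pow_symbol_one (hε0 : 0 < ε) (hε : ε < 1 / 2)
    (hlam : ∀ j, 1 ≤ j → 0 < lam j) (hc0 : 0 ≤ c)
    (hc : ∑ j ∈ Finset.Icc 1 n, lam j + |c| ≤ 1) (s : ℕ) :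
    (1 - 2 * ε) * c ≤ (transfer (truncatedProb ε lam m n c) ^ (s + 1)) symbol 1 := by
  set q := truncatedProb ε lam m n c with hq
  set G : Past ℤˣ → ℝ := fun x => ∑ j ∈ Finset.Icc 1 n, lam j * majority (m j) x with hG
  have hGm : Monotone G := monotone_sum_majority hlam
  have hGo : ∀ x, G (-x) = -G x := fun x => by
    simp [hG, majority_neg, Finset.sum_neg_distrib]
  have hatt : IsAttractive q := isAttractive_truncatedProb hε0 hε hlam hc
  have hsym : IsAttractive (truncatedProb ε lam m n 0) :=
    isAttractive_truncatedProb hε0 hε hlam (by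
      rw [abs_zero]; linarith [abs_nonneg c])
  have hle : truncatedProb ε lam m n 0 ≤ q := fun x => by
    simp only [hq, truncatedProb]; nlinarith
  have hodd : ∀ x, truncatedProb ε lam m n 0 (-x) = 1 - truncatedProb ε lam m n 0 x := by
    intro x
    have := hGo x
    simp only [hG] at this
    simp only [truncatedProb, this]
    ring
  -- Without bias the evolved `G` is odd and monotone, hence nonnegative at `1`; the bias `c ≥ 0`
  -- only raises it.
  have hG0 : 0 ≤ (transfer q ^ s) G 1 := by
    refine le_trans ?_ (hsym.transfer_pow_le_transfer_pow hatt hle hGm s 1)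
    have a := transfer_pow_odd hodd hGo s 1
    have b := hsym.monotone_transfer_pow hGm s (neg_one_le_past 1)
    linarith
  have hT : transfer q symbol = (1 - 2 * ε) • G + fun _ => (1 - 2 * ε) * c := by
    funext x
    rw [transfer_symbol]
    simp only [hq, truncatedProb, hG, Pi.add_apply, Pi.smul_apply, smul_eq_mul]
    ring
  rw [pow_succ, Module.End.mul_apply, hT, map_add, map_smul, transfer_pow_const]
  simp only [Pi.add_apply, Pi.smul_apply, smul_eq_mul]
  nlinarith

end Truncated

/-! ### Weights, the Chernoff bound and the induction over scales -/

section Weights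

variable {lam : ℕ → ℝ}

theorem sum_Icc_add_tail (hsum : HasSum (fun j : ℕ => lam (j + 1)) 1) (k : ℕ) :
    ∑ j ∈ Finset.Icc 1 k, lam j + ∑' j : ℕ, lam (k + 1 + j) = 1 := by
  have h := hsum.summable.sum_add_tsum_nat_add k
  rw [hsum.tsum_eq, Finset.range_eq_Ico, Finset.sum_Ico_add' lam 0 k 1] at h
  have e : ∀ j, lam (k + 1 + j) = lam (j + k + 1) := fun j => by congr 1; ring
  simp only [e]
  exact h

theorem sum_Icc_split {r k : ℕ} (hr : r ≤ k) (f : ℕ → ℝ) :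
    ∑ j ∈ Finset.Icc 1 k, f j =
      ∑ j ∈ Finset.Icc 1 r, f j + ∑ j ∈ Finset.Icc (r + 1) k, f j := by
  have h := Finset.sum_Ico_consecutive f (Nat.le_add_left 1 r) (Nat.succ_le_succ hr)
  exact h.symm

theorem tail_nonneg (hlam : ∀ j, 1 ≤ j → 0 < lam j) (k : ℕ) : 0 ≤ ∑' j : ℕ, lam (k + 1 + j) :=
  tsum_nonneg fun j => (hlam _ (by omega)).le

theorem sum_Icc_nonneg (hlam : ∀ j, 1 ≤ j → 0 < lam j) (a k : ℕ) :
    0 ≤ ∑ j ∈ Finset.Icc (a + 1) k, lam j :=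
  Finset.sum_nonneg fun j hj => (hlam j (by have := (Finset.mem_Icc.1 hj).1; omega)).le

end Weights

/-- The choice `θ = D / (4 * B ^ 2)` minimizes `2 * B ^ 2 * θ ^ 2 * N - θ * N * D`. The boundary
term is then `D / (2 * B) ≤ 1 / 2`, which costs a factor of at most `2`. -/
theorem exp_chernoff_le {B D N X : ℝ} (hB : 1 ≤ B) (hD0 : 0 < D) (hD1 : D ≤ 1) (hX : 0 < X)
    (h : Real.log X ≤ N * D ^ 2 / (8 * B ^ 2)) :
    Real.exp (2 * B ^ 2 * (D / (4 * B ^ 2)) ^ 2 * N - D / (4 * B ^ 2) * (N * D - 2 * B)) ≤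
      2 / X := by
  have hBpos : 0 < B := by linarith
  have e : 2 * B ^ 2 * (D / (4 * B ^ 2)) ^ 2 * N - D / (4 * B ^ 2) * (N * D - 2 * B) =
      -(N * D ^ 2 / (8 * B ^ 2)) + D / (2 * B) := by
    field_simp; ring
  have h2 : D / (2 * B) ≤ 1 / 2 := by
    rw [div_le_div_iff₀ (by positivity) (by norm_num)]; linarith
  have h3 : Real.exp (1 / 2) ≤ 2 := by
    have h4 : Real.exp (1 / 2) ^ 2 = Real.exp 1 := by rw [← Real.exp_nat_mul]; norm_num
    nlinarith [Real.exp_one_lt_d9, Real.exp_pos (1 / 2)]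
  rw [e]
  calc _ ≤ Real.exp (-Real.log X + 1 / 2) := Real.exp_le_exp.2 (by linarith)
    _ = Real.exp (1 / 2) / X := by
        rw [Real.exp_add, Real.exp_neg, Real.exp_log hX]; ring
    _ ≤ 2 / X := by gcongr

section Model

variable {ε : ℝ} {lam : ℕ → ℝ} {m r : ℕ → ℕ} {α : ℝ}

/-- The worst case for the scales `l + 1, …, k` is that they all vote `-1`. -/
theorem truncatedProb_le_truncatedProb (hε : ε < 1 / 2) (hlam : ∀ j, 1 ≤ j → 0 < lam j)
    {l k : ℕ} (hlk : l ≤ k) {δ t : ℝ} (hδ : δ = t - ∑ j ∈ Finset.Icc (l + 1) k, lam j) :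
    truncatedProb ε lam m l δ ≤ truncatedProb ε lam m k t := by
  intro x
  have e1 := sum_Icc_split hlk fun j => lam j * majority (m j) x
  have e2 : -∑ j ∈ Finset.Icc (l + 1) k, lam j ≤
      ∑ j ∈ Finset.Icc (l + 1) k, lam j * majority (m j) x := by
    rw [← Finset.sum_neg_distrib]
    refine Finset.sum_le_sum fun j hj => ?_
    have hj := hlam j (by have := (Finset.mem_Icc.1 hj).1; omega)
    nlinarith [(abs_le.1 (abs_majority_le_one (m j) x)).1]
  unfold truncatedProb
  rw [e1]
  refine add_le_add_right (mul_le_mul_of_nonneg_left ?_ (by linarith)) _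
  linarith

theorem truncatedProb_sub_succ_le (hε0 : 0 < ε) (hε : ε < 1 / 2) {k : ℕ} {t t' θ : ℝ}
    (h0 : 0 ≤ lam (k + 1)) (h1 : lam (k + 1) ≤ 1) (ht : t - t' = lam (k + 1)) (hθ : 0 ≤ θ)
    (x : Past ℤˣ) :
    truncatedProb ε lam m k t x - truncatedProb ε lam m (k + 1) t' x ≤
      Real.exp (-θ * magnetization (m (k + 1)) x) := by
  have e1 : ∑ j ∈ Finset.Icc 1 (k + 1), lam j * majority (m j) x =
      ∑ j ∈ Finset.Icc 1 k, lam j * majority (m j) x + lam (k + 1) * majority (m (k + 1)) x :=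
    Finset.sum_Icc_succ_top (by omega) _
  have e2 := one_sub_majority_le hθ (m (k + 1)) x
  have e3 := (Real.exp_pos (-θ * magnetization (m (k + 1)) x)).le
  have e7 : truncatedProb ε lam m k t x - truncatedProb ε lam m (k + 1) t' x =
      (1 / 2 - ε) * lam (k + 1) * (1 - majority (m (k + 1)) x) := by
    unfold truncatedProb
    rw [e1, ← ht]
    ring
  rw [e7]
  have e8 : (1 / 2 - ε) * lam (k + 1) ≤ 1 / 2 := by nlinarith
  have e9 : 0 ≤ (1 / 2 - ε) * lam (k + 1) := mul_nonneg (by linarith) h0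
  calc _ ≤ (1 / 2 - ε) * lam (k + 1) * (2 * Real.exp (-θ * magnetization (m (k + 1)) x)) :=
        mul_le_mul_of_nonneg_left e2 e9
    _ ≤ 1 / 2 * (2 * Real.exp (-θ * magnetization (m (k + 1)) x)) :=
        mul_le_mul_of_nonneg_right e8 (by linarith)
    _ = _ := by ring

/-- The growth condition on `m (k + 1)`, rewritten as the hypothesis of `exp_chernoff_le`. -/
theorem log_le_of_constA_le (hε : ε < 1 / 2) {k : ℕ} (hδ : 0 < gap lam r k)
    (hB : 0 < 1 + (m (r (k + 1)) : ℝ) * (2 * ε) ^ (-(m (r (k + 1)) : ℤ)))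
    (hm : constA ε α m r k / gap lam r k ^ 2 ≤ (m (k + 1) : ℝ)) :
    Real.log (2 ^ (k + 2) * (1 + (m k : ℝ) * (2 * ε) ^ (-(m k : ℤ))) * α⁻¹) ≤
      (m (k + 1) : ℝ) * ((1 - 2 * ε) * gap lam r k) ^ 2 /
        (8 * (1 + (m (r (k + 1)) : ℝ) * (2 * ε) ^ (-(m (r (k + 1)) : ℤ))) ^ 2) := by
  rw [constA, div_le_iff₀ (by positivity)] at hm
  set B := 1 + (m (r (k + 1)) : ℝ) * (2 * ε) ^ (-(m (r (k + 1)) : ℤ))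
  set L := Real.log (2 ^ (k + 2) * (1 + (m k : ℝ) * (2 * ε) ^ (-(m k : ℤ))) * α⁻¹)
  have h12 : 0 < 1 - 2 * ε := by linarith
  rw [le_div_iff₀ (by positivity)]
  have e : (1 - 2 * ε) ^ 2 * (1 - 2 * ε) ^ (-2 : ℤ) = 1 := by
    rw [zpow_neg]; exact mul_inv_cancel₀ (by positivity)
  calc L * (8 * B ^ 2) = (1 - 2 * ε) ^ 2 * (8 * (1 - 2 * ε) ^ (-2 : ℤ) * B ^ 2 * L) := by
        linear_combination (-(8 * B ^ 2 * L)) * e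
    _ ≤ (1 - 2 * ε) ^ 2 * (m (k + 1) * gap lam r k ^ 2) := by gcongr
    _ = _ := by ring

theorem transfer_truncated_step (hε0 : 0 < ε) (hε : ε < 1 / 2) (hm_mono : StrictMono m)
    (hlam : ∀ j, 1 ≤ j → 0 < lam j) (hsum : HasSum (fun j : ℕ => lam (j + 1)) 1)
    (hα0 : 0 < α) {k : ℕ} (hr : r (k + 1) < k + 1)
    (hgap : ∑ j ∈ Finset.Icc (r (k + 1) + 1) (k + 1), lam j < ∑' j : ℕ, lam (k + 2 + j))
    (hm : constA ε α m r k / gap lam r k ^ 2 ≤ (m (k + 1) : ℝ)) (n : ℕ) :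
    (transfer (truncatedProb ε lam m k (∑' j : ℕ, lam (k + 1 + j))) ^ n) symbol 1 ≤
      (transfer (truncatedProb ε lam m (k + 1) (∑' j : ℕ, lam (k + 2 + j))) ^ n) symbol 1 +
        α / 2 ^ k := by
  have hk := sum_Icc_add_tail hsum k
  have hk1 := sum_Icc_add_tail hsum (k + 1)
  rw [show k + 1 + 1 = k + 2 from rfl] at hk1
  have ht := tail_nonneg hlam k
  have ht1 : 0 ≤ ∑' j : ℕ, lam (k + 2 + j) := tail_nonneg hlam (k + 1)
  have hsplit := sum_Icc_split hr.le lam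
  have hs0 := sum_Icc_nonneg hlam 0 k
  have hs1 := sum_Icc_nonneg hlam 0 (r (k + 1))
  have hs2 := sum_Icc_nonneg hlam (r (k + 1)) (k + 1)
  rw [zero_add] at hs0 hs1
  have hsucc : ∑ j ∈ Finset.Icc 1 (k + 1), lam j = ∑ j ∈ Finset.Icc 1 k, lam j + lam (k + 1) :=
    Finset.sum_Icc_succ_top (by omega) lam
  have hgdef : gap lam r k = ∑' j : ℕ, lam (k + 2 + j) -
    ∑ j ∈ Finset.Icc (r (k + 1) + 1) (k + 1), lam j := rfl
  set t := ∑' j : ℕ, lam (k + 1 + j)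
  set t' := ∑' j : ℕ, lam (k + 2 + j)
  set δ := gap lam r k
  have hδ : 0 < δ := by rw [hgdef]; linarith
  have hδ1 : δ ≤ 1 := by linarith
  have hcu : ∑ j ∈ Finset.Icc 1 k, lam j + |t| ≤ 1 := by rw [abs_of_nonneg ht]; exact hk.le
  have hcv : ∑ j ∈ Finset.Icc 1 (k + 1), lam j + |t'| ≤ 1 := by
    rw [abs_of_nonneg ht1]; exact hk1.le
  have hcq : ∑ j ∈ Finset.Icc 1 (r (k + 1)), lam j + |δ| ≤ 1 := by
    rw [abs_of_pos hδ]; linarith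
  have hu : IsAttractive (truncatedProb ε lam m k t) :=
    isAttractive_truncatedProb hε0 hε hlam hcu
  have hv : IsAttractive (truncatedProb ε lam m (k + 1) t') :=
    isAttractive_truncatedProb hε0 hε hlam hcv
  have hq : IsAttractive (truncatedProb ε lam m (r (k + 1)) δ) :=
    isAttractive_truncatedProb hε0 hε hlam hcq
  set Br : ℝ := 1 + (m (r (k + 1)) : ℝ) * (2 * ε) ^ (-(m (r (k + 1)) : ℤ)) with hBr
  set Bk : ℝ := 1 + (m k : ℝ) * (2 * ε) ^ (-(m k : ℤ)) with hBk
  have hBr1 : 1 ≤ Br := le_add_of_nonneg_right (by positivity)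
  have hBk1 : 1 ≤ Bk := le_add_of_nonneg_right (by positivity)
  set D := (1 - 2 * ε) * δ with hD
  have hDpos : 0 < D := mul_pos (by linarith) hδ
  have hD1 : D ≤ 1 := by nlinarith
  set θ := D / (4 * Br ^ 2) with hθ
  have hθ0 : 0 ≤ θ := by positivity
  set F : Past ℤˣ → ℝ := fun y => Real.exp (-θ * magnetization (m (k + 1)) y) with hF
  have hFm : Monotone (-F) := fun x y h => neg_le_neg (Real.exp_le_exp.2 (by
    nlinarith [magnetization_monotone (m (k + 1)) h]))
  have hqv : truncatedProb ε lam m (r (k + 1)) δ ≤ truncatedProb ε lam m (k + 1) t' := truncatedProb_le_truncatedProb hε hlam hr.le hgdef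
  have huv : ∀ x, truncatedProb ε lam m k t x - truncatedProb ε lam m (k + 1) t' x ≤ F x :=
    truncatedProb_sub_succ_le hε0 hε (hlam (k + 1) (by omega)).le (by linarith) (by linarith) hθ0
  -- Chosen so that the defect bound `2 / X` times the memory bound `2 * Bk` is exactly `α / 2 ^ k`.
  set X : ℝ := 2 ^ (k + 2) * Bk * α⁻¹ with hX
  have hXpos : 0 < X := by positivity
  have hlog : Real.log X ≤ (m (k + 1) : ℝ) * D ^ 2 / (8 * Br ^ 2) :=
    log_le_of_constA_le hε hδ (by linarith) hm
  -- Defects are estimated for the smaller chain of range `m (r (k + 1))`: since `F` is antitone,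
  -- lowering the chain increases its mean.
  have hP : ∀ i, (transfer (truncatedProb ε lam m (k + 1) t') ^ i) F 1 ≤ 2 / X := by
    intro i
    have h1 := hq.transfer_pow_le_transfer_pow hv hqv hFm i 1
    simp only [map_neg, Pi.neg_apply, neg_le_neg_iff] at h1
    refine h1.trans (le_trans ?_ (exp_chernoff_le hBr1 hDpos hD1 hXpos hlog))
    have hmem := fun x => truncatedProb_mem (m := m) hε hlam hcq x
    have hdep := dependsOn_truncatedProb (ε := ε) (lam := lam) (n := r (k + 1)) (c := δ)
      hm_mono.monotone
    refine hq.transfer_pow_exp_magnetization_le_uniform (B := Br) (D := D) ?_ ?_ ?_ hθ0 _ i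
    · exact sum_oscillation_symbol_le hε0 hq.mono (fun x => (hmem x).1) (fun x => (hmem x).2) hdep
    · intro n
      have := sum_oscillation_transfer_symbol_le hε0 hq.mono (fun x => (hmem x).1)
        (fun x => (hmem x).2) hdep n
      linarith
    · exact le_transfer_pow_symbol_one hε0 hε hlam hδ.le hcq
  have hfin := hu.transfer_pow_le_transfer_pow_add hv symbol_monotone
    (fun x => (Real.exp_pos _).le) huv hP 0 n
  simp only [pow_zero, Module.End.one_apply, zero_add] at hfin
  refine hfin.trans (add_le_add_right ?_ _)
  have hmem := fun x => truncatedProb_mem (m := m) hε hlam hcu x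
  have hosc := sum_oscillation_symbol_le hε0 hu.mono (fun x => (hmem x).1)
    (fun x => (hmem x).2) (dependsOn_truncatedProb hm_mono.monotone) n
  calc _ ≤ 2 / X * (2 * Bk) := mul_le_mul_of_nonneg_left hosc (by positivity)
    _ = α / 2 ^ k := by
      rw [hX, pow_add]
      field_simp

theorem le_transfer_truncated (hε0 : 0 < ε) (hε : ε < 1 / 2) (hm_mono : StrictMono m)
    (hlam : ∀ j, 1 ≤ j → 0 < lam j) (hsum : HasSum (fun j : ℕ => lam (j + 1)) 1)
    (hr : ∀ k, 1 ≤ k → r k < k) (hα0 : 0 < α)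
    (hgap : ∀ k : ℕ,
      ∑ j ∈ Finset.Icc (r (k + 1) + 1) (k + 1), lam j < ∑' j : ℕ, lam (k + 2 + j))
    (hm : ∀ k : ℕ, constA ε α m r k / gap lam r k ^ 2 ≤ (m (k + 1) : ℝ)) (n k : ℕ) :
    1 - 2 * ε - 2 * α * (1 - 1 / 2 ^ k) ≤
      (transfer (truncatedProb ε lam m k (∑' j : ℕ, lam (k + 1 + j))) ^ n) symbol 1 := by
  induction k with
  | zero =>
    have h1 := sum_Icc_add_tail hsum 0
    simp only [Finset.Icc_eq_empty_of_lt Nat.one_pos, Finset.sum_empty, zero_add] at h1 ⊢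
    rw [h1]
    -- The chain is now a sequence of independent coins of mean `1 - 2ε`, except that the symbol at
    -- time `0` is `1`.
    cases n with
    | zero => simp only [pow_zero, Module.End.one_apply, symbol_one]; linarith
    | succ n =>
      have := le_transfer_pow_symbol_one (m := m) (n := 0) (c := 1) hε0 hε hlam zero_le_one
        (by simp) n
      linarith
  | succ k ih =>
    have := transfer_truncated_step hε0 hε hm_mono hlam hsum hα0 (hr (k + 1) (by omega))
      (hgap k) (hm k) n
    have e : α / 2 ^ k = 2 * α * (1 / 2 ^ k - 1 / 2 ^ (k + 1)) := by
      rw [pow_succ]; field_simp; ring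
    rw [show k + 1 + 1 = k + 2 from rfl]
    rw [e] at this
    linarith

theorem summable_majority (hlam : ∀ j, 1 ≤ j → 0 < lam j)
    (hsum : HasSum (fun j : ℕ => lam (j + 1)) 1) (x : Past ℤˣ) :
    Summable fun j : ℕ => lam (j + 1) * majority (m (j + 1)) x := by
  refine Summable.of_norm_bounded hsum.summable fun j => ?_
  have hj := hlam (j + 1) (by omega)
  rw [Real.norm_eq_abs, abs_mul, abs_of_pos hj]
  nlinarith [abs_majority_le_one (m (j + 1)) x]

theorem abs_truncatedProb_sub_fullProb_le (hε0 : 0 < ε) (hε : ε < 1 / 2)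
    (hlam : ∀ j, 1 ≤ j → 0 < lam j) (hsum : HasSum (fun j : ℕ => lam (j + 1)) 1) (k : ℕ)
    (x : Past ℤˣ) :
    |truncatedProb ε lam m k (∑' j : ℕ, lam (k + 1 + j)) x - fullProb ε lam m x| ≤
      ∑' j : ℕ, lam (k + 1 + j) := by
  have hS := summable_majority (m := m) hlam hsum x
  have h := hS.sum_add_tsum_nat_add k
  rw [Finset.range_eq_Ico,
    Finset.sum_Ico_add' (fun j => lam j * majority (m j) x) 0 k 1] at h
  have hs : Summable fun j : ℕ => lam (j + k + 1) :=
    (summable_nat_add_iff (f := fun j : ℕ => lam (j + 1)) k).2 hsum.summable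
  have hS' : Summable fun j : ℕ => lam (j + k + 1) * majority (m (j + k + 1)) x :=
    (summable_nat_add_iff (f := fun j : ℕ => lam (j + 1) * majority (m (j + 1)) x) k).2 hS
  have e : ∀ j, lam (k + 1 + j) = lam (j + k + 1) := fun j => by congr 1; ring
  have hb : |∑' j : ℕ, lam (j + k + 1) * majority (m (j + k + 1)) x| ≤
      ∑' j : ℕ, lam (j + k + 1) := by
    rw [← Real.norm_eq_abs]
    refine tsum_of_norm_bounded hs.hasSum fun j => ?_
    have hj := hlam (j + k + 1) (by omega)
    rw [Real.norm_eq_abs, abs_mul, abs_of_pos hj]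
    nlinarith [abs_majority_le_one (m (j + k + 1)) x]
  simp only [e, truncatedProb, fullProb, ← h]
  rw [show Finset.Ico (0 + 1) (k + 1) = Finset.Icc 1 k from rfl]
  rw [abs_le] at hb ⊢
  constructor <;> nlinarith

theorem fullProb_mem (hε0 : 0 < ε) (hε : ε < 1 / 2) (hlam : ∀ j, 1 ≤ j → 0 < lam j)
    (hsum : HasSum (fun j : ℕ => lam (j + 1)) 1) (x : Past ℤˣ) :
    0 ≤ fullProb ε lam m x ∧ fullProb ε lam m x ≤ 1 := by
  have hb : |∑' j : ℕ, lam (j + 1) * majority (m (j + 1)) x| ≤ 1 := by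
    rw [← Real.norm_eq_abs]
    refine tsum_of_norm_bounded hsum fun j => ?_
    have hj := hlam (j + 1) (by omega)
    rw [Real.norm_eq_abs, abs_mul, abs_of_pos hj]
    nlinarith [abs_majority_le_one (m (j + 1)) x]
  rw [abs_le] at hb
  unfold fullProb
  constructor <;> nlinarith

theorem le_transfer_full (hε0 : 0 < ε) (hε : ε < 1 / 2) (hm_mono : StrictMono m)
    (hlam : ∀ j, 1 ≤ j → 0 < lam j) (hsum : HasSum (fun j : ℕ => lam (j + 1)) 1)
    (hr : ∀ k, 1 ≤ k → r k < k) (hα0 : 0 < α)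
    (hgap : ∀ k : ℕ,
      ∑ j ∈ Finset.Icc (r (k + 1) + 1) (k + 1), lam j < ∑' j : ℕ, lam (k + 2 + j))
    (hm : ∀ k : ℕ, constA ε α m r k / gap lam r k ^ 2 ≤ (m (k + 1) : ℝ)) (n : ℕ) :
    1 - 2 * ε - 2 * α ≤ (transfer (fullProb ε lam m) ^ n) symbol 1 := by
  have htail : Filter.Tendsto (fun k : ℕ => ∑' j : ℕ, lam (k + 1 + j)) Filter.atTop (nhds 0) := by
    have := tendsto_sum_nat_add fun j : ℕ => lam (j + 1)
    refine this.congr fun k => tsum_congr fun j => ?_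
    congr 1; ring
  have hlim : Filter.Tendsto (fun k : ℕ => 1 - 2 * ε - 2 * α -
      n * (2 * ∑' j : ℕ, lam (k + 1 + j))) Filter.atTop (nhds (1 - 2 * ε - 2 * α)) := by
    simpa using ((htail.const_mul 2).const_mul (n : ℝ)).const_sub (1 - 2 * ε - 2 * α)
  -- The time `n` is fixed while `k → ∞`, so the truncation error, linear in `n`, vanishes.
  refine le_of_tendsto' hlim fun k => ?_
  have hatt : IsAttractive (truncatedProb ε lam m k (∑' j : ℕ, lam (k + 1 + j))) :=
    isAttractive_truncatedProb hε0 hε hlam (by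
      rw [abs_of_nonneg (tail_nonneg hlam k)]; exact (sum_Icc_add_tail hsum k).le)
  have h1 := le_transfer_truncated hε0 hε hm_mono hlam hsum hr hα0 hgap hm n k
  have h2 := abs_transfer_pow_sub_le hatt.nonneg hatt.le_one
    (fun x => (fullProb_mem (m := m) hε0 hε hlam hsum x).1)
    (fun x => (fullProb_mem hε0 hε hlam hsum x).2)
    (abs_truncatedProb_sub_fullProb_le hε0 hε hlam hsum k) (f := symbol)
    (fun x => (abs_symbol x).le) n 1
  have h3 : (0 : ℝ) < 1 / 2 ^ k := by positivity
  have h4 := (abs_le.1 h2).2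
  nlinarith

end Model

/-! ### Existence of stationary measures (Krylov–Bogoliubov) -/

theorem continuous_cons (a : ℤˣ) : Continuous (Past.cons a : Past ℤˣ → Past ℤˣ) :=
  continuous_pi fun n => by
    cases n with
    | zero => exact continuous_const
    | succ n => exact continuous_apply n

theorem continuous_shift : Continuous (Past.shift : Past ℤˣ → Past ℤˣ) :=
  continuous_pi fun n => continuous_apply (n + 1)

theorem shift_cons (a : ℤˣ) (x : Past ℤˣ) : Past.shift (Past.cons a x) = x := rfl

theorem continuous_transfer {u f : Past ℤˣ → ℝ} (hu : Continuous u) (hf : Continuous f) :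
    Continuous (transfer u f) :=
  (hu.mul (hf.comp (continuous_cons 1))).add
    ((continuous_const.sub hu).mul (hf.comp (continuous_cons (-1))))

/-- The average of `f` over the first `N + 1` steps of the chain started from `x₀`. -/
noncomputable def cesaro (u : Past ℤˣ → ℝ) (x₀ : Past ℤˣ) (N : ℕ) :
    (Past ℤˣ → ℝ) →ₗ[ℝ] ℝ :=
  (N + 1 : ℝ)⁻¹ • ∑ n ∈ Finset.range (N + 1), LinearMap.proj x₀ ∘ₗ (transfer u ^ n)

theorem cesaro_apply (u : Past ℤˣ → ℝ) (x₀ : Past ℤˣ) (N : ℕ) (f : Past ℤˣ → ℝ) :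
    cesaro u x₀ N f = (N + 1 : ℝ)⁻¹ * ∑ n ∈ Finset.range (N + 1), (transfer u ^ n) f x₀ := by
  simp [cesaro, LinearMap.sum_apply]

section Cesaro

variable {u f : Past ℤˣ → ℝ}

theorem le_cesaro (x₀ : Past ℤˣ) {c : ℝ} (hc : ∀ n, c ≤ (transfer u ^ n) f x₀) (N : ℕ) :
    c ≤ cesaro u x₀ N f := by
  rw [cesaro_apply, inv_mul_eq_div, le_div_iff₀ (by positivity)]
  calc c * (N + 1) = ∑ n ∈ Finset.range (N + 1), c := by simp [mul_comm]
    _ ≤ _ := Finset.sum_le_sum fun n _ => hc n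

theorem abs_cesaro_le (h0 : ∀ x, 0 ≤ u x) (h1 : ∀ x, u x ≤ 1) (x₀ : Past ℤˣ) {C : ℝ}
    (hf : ∀ x, |f x| ≤ C) (N : ℕ) : |cesaro u x₀ N f| ≤ C := by
  have a := le_cesaro (f := f) x₀ (fun n => le_transfer_pow h0 h1
    (fun x => (abs_le.1 (hf x)).1) n x₀) N
  have b := le_cesaro (f := -f) x₀ (fun n => le_transfer_pow h0 h1
    (fun x => neg_le_neg (abs_le.1 (hf x)).2) n x₀) N
  rw [map_neg] at b
  exact abs_le.2 ⟨a, by linarith⟩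

theorem tendsto_cesaro_transfer_sub (h0 : ∀ x, 0 ≤ u x) (h1 : ∀ x, u x ≤ 1) (x₀ : Past ℤˣ)
    {C : ℝ} (hf : ∀ x, |f x| ≤ C) :
    Tendsto (fun N => cesaro u x₀ N (transfer u f - f)) atTop (𝓝 0) := by
  refine squeeze_zero_norm (a := fun N : ℕ => 2 * C * (1 / ((N : ℝ) + 1))) (fun N => ?_) (by
    simpa using tendsto_one_div_add_atTop_nhds_zero_nat.const_mul (2 * C))
  have htel : ∑ n ∈ Finset.range (N + 1), (transfer u ^ n) (transfer u f - f) x₀ =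
      (transfer u ^ (N + 1)) f x₀ - f x₀ := by
    simp only [map_sub, Pi.sub_apply, ← Module.End.mul_apply, ← pow_succ]
    exact Finset.sum_range_sub (fun n => (transfer u ^ n) f x₀) (N + 1)
  have hN := transfer_pow_le h0 h1 (fun x => (abs_le.1 (hf x)).2) (N + 1) x₀
  have hN' := le_transfer_pow h0 h1 (fun x => (abs_le.1 (hf x)).1) (N + 1) x₀
  have hx := abs_le.1 (hf x₀)
  have hpos : (0 : ℝ) < N + 1 := by positivity
  rw [cesaro_apply, htel, Real.norm_eq_abs, abs_mul, abs_of_pos (inv_pos.2 hpos), one_div, mul_comm]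
  refine mul_le_mul_of_nonneg_right ?_ (inv_pos.2 hpos).le
  rw [abs_le]
  constructor <;> linarith

/-- Bounded sequences converge along an ultrafilter. This gives all continuous `f` a limit at once,
without extracting subsequences, and the limit is linear and positive in `f`. -/
theorem tendsto_cesaro_hyperfilter (h0 : ∀ x, 0 ≤ u x) (h1 : ∀ x, u x ≤ 1) (x₀ : Past ℤˣ)
    (hf : Continuous f) :
    Tendsto (fun N => cesaro u x₀ N f) (hyperfilter ℕ)
      (𝓝 (limUnder (hyperfilter ℕ : Filter ℕ) fun N => cesaro u x₀ N f)) := by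
  obtain ⟨C, hC⟩ := isCompact_univ.exists_bound_of_continuousOn hf.continuousOn
  have hC' : ∀ x, |f x| ≤ C := fun x => hC x (Set.mem_univ x)
  obtain ⟨l, -, hl⟩ := (isCompact_Icc (a := -C) (b := C)).ultrafilter_le_nhds
    ((hyperfilter ℕ).map fun N => cesaro u x₀ N f) (by
      rw [le_principal_iff]
      exact Filter.mem_map.2 (Filter.univ_mem' fun N : ℕ =>
        abs_le.1 (abs_cesaro_le h0 h1 x₀ hC' N)))
  exact tendsto_nhds_limUnder ⟨l, hl⟩

/-- A probability measure which is stationary for the chain, obtained as a limit of Cesàro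
averages along the trajectory started from `x₀`. -/
theorem exists_stationary (hu : Continuous u) (h0 : ∀ x, 0 ≤ u x) (h1 : ∀ x, u x ≤ 1)
    (x₀ : Past ℤˣ) :
    ∃ μ : Measure (Past ℤˣ), IsProbabilityMeasure μ ∧
      (∀ f, Continuous f → ∫ x, transfer u f x ∂μ = ∫ x, f x ∂μ) ∧
      ∀ f, Continuous f → ∀ c, (∀ n, c ≤ (transfer u ^ n) f x₀) → c ≤ ∫ x, f x ∂μ := by
  set Λ₀ : (Past ℤˣ → ℝ) → ℝ := fun f =>
    limUnder (hyperfilter ℕ : Filter ℕ) fun N => cesaro u x₀ N f with hΛ₀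
  have hlim : ∀ f, Continuous f →
      Tendsto (fun N => cesaro u x₀ N f) (hyperfilter ℕ) (𝓝 (Λ₀ f)) :=
    fun f hf => tendsto_cesaro_hyperfilter h0 h1 x₀ hf
  have hge : ∀ f, Continuous f → ∀ c, (∀ n, c ≤ (transfer u ^ n) f x₀) → c ≤ Λ₀ f :=
    fun f hf c hc => ge_of_tendsto' (hlim f hf) (le_cesaro x₀ hc)
  -- The space of pasts is compact, so compact support is automatic and Riesz–Markov–Kakutani turns
  -- the limit functional into a measure.
  let Λ : CompactlySupportedContinuousMap (Past ℤˣ) ℝ →ₚ[ℝ] ℝ := PositiveLinearMap.mk₀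
    { toFun := fun f => Λ₀ f
      map_add' := fun f g => by
        refine tendsto_nhds_unique (hlim _ (f + g).continuous)
          (((hlim f f.continuous).add (hlim g g.continuous)).congr fun N => ?_)
        rw [← map_add]; rfl
      map_smul' := fun c f => by
        refine tendsto_nhds_unique (hlim _ (c • f).continuous)
          (((hlim f f.continuous).const_mul c).congr fun N => ?_)
        rw [← smul_eq_mul, ← map_smul]; rfl }
    (fun f hf => hge f f.continuous 0 fun n => le_transfer_pow h0 h1 hf n x₀)
  have hΛ : ∀ f, Continuous f → ∫ x, f x ∂(RealRMK.rieszMeasure Λ) = Λ₀ f := fun f hf =>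
    RealRMK.integral_rieszMeasure Λ ⟨⟨f, hf⟩, HasCompactSupport.of_compactSpace f⟩
  refine ⟨RealRMK.rieszMeasure Λ, ⟨?_⟩, fun f hf => ?_, fun f hf c hc => ?_⟩
  · have h := hΛ (fun _ => 1) continuous_const
    have hone : Λ₀ (fun _ => 1) = 1 := by
      refine le_antisymm ?_ (hge _ continuous_const 1 fun n => by rw [transfer_pow_const])
      refine le_of_tendsto' (hlim _ continuous_const) fun N => ?_
      exact (abs_le.1 (abs_cesaro_le h0 h1 x₀ (fun _ => by simp) N)).2
    rw [hone, integral_const, smul_eq_mul, mul_one, Measure.real] at h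
    exact (ENNReal.toReal_eq_one_iff _).1 h
  · rw [hΛ f hf, hΛ _ (continuous_transfer hu hf)]
    obtain ⟨C, hC⟩ := isCompact_univ.exists_bound_of_continuousOn hf.continuousOn
    have hz := (tendsto_cesaro_transfer_sub h0 h1 x₀
      (fun x => hC x (Set.mem_univ x))).mono_left Nat.hyperfilter_le_atTop
    have hd := (hlim _ (continuous_transfer hu hf)).sub (hlim f hf)
    refine sub_eq_zero.1 (tendsto_nhds_unique (hd.congr fun N => ?_) hz)
    rw [map_sub]
  · rw [hΛ f hf]
    exact hge f hf c hc

end Cesaro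

/-! ### From stationarity to compatibility -/

section GMeasure

variable {u : Past ℤˣ → ℝ} {g : Past ℤˣ → ℝ} {μ : Measure (Past ℤˣ)}

theorem isGMeasure_of_stationary (hu : Continuous u) (h0 : ∀ x, 0 ≤ u x) (h1 : ∀ x, u x ≤ 1)
    (hg1 : ∀ x, g (Past.cons 1 x) = u x) (hg2 : ∀ x, g (Past.cons (-1) x) = 1 - u x)
    [IsProbabilityMeasure μ]
    (hμ : ∀ f, Continuous f → ∫ x, transfer u f x ∂μ = ∫ x, f x ∂μ) : IsGMeasure g μ := by
  have hgc : ∀ a : ℤˣ, Continuous fun x => g (Past.cons a x) := fun a => by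
    rcases Int.units_eq_one_or a with rfl | rfl
    · simp only [hg1]; exact hu
    · simp only [hg2]; exact continuous_const.sub hu
  have hg0 : ∀ (a : ℤˣ) x, 0 ≤ g (Past.cons a x) := fun a x => by
    rcases Int.units_eq_one_or a with rfl | rfl
    · rw [hg1]; exact h0 x
    · rw [hg2]; exact sub_nonneg.2 (h1 x)
  have hgle : ∀ (a : ℤˣ) x, g (Past.cons a x) ≤ 1 := fun a x => by
    rcases Int.units_eq_one_or a with rfl | rfl
    · rw [hg1]; exact h1 x
    · rw [hg2]; linarith [h0 x]
  have hshift : Measurable (Past.shift : Past ℤˣ → Past ℤˣ) := continuous_shift.measurable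
  have hT : ∀ f x, transfer u f x = ∑ a : ℤˣ, g (Past.cons a x) * f (Past.cons a x) := by
    intro f x
    rw [transfer_apply, show (Finset.univ : Finset ℤˣ) = {1, -1} from rfl,
      Finset.sum_pair (by decide), hg1, hg2]
  have hopen : ∀ a : ℤˣ, IsClopen {x : Past ℤˣ | x 0 = a} := fun a =>
    (isClopen_discrete {a}).preimage (continuous_apply 0)
  have hmeas : ∀ a : ℤˣ, MeasurableSet {x : Past ℤˣ | x 0 = a} := fun a =>
    (hopen a).isOpen.measurableSet
  -- Stationarity is tested on `f ∘ shift` cut off to a cylinder. This is continuous because the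
  -- cylinder is clopen, and the transfer operator sends it to `g (a ·) * f`.
  have hcyl : ∀ (a : ℤˣ) (f : Past ℤˣ → ℝ), Continuous f →
      ∫ x in {x : Past ℤˣ | x 0 = a}, f (Past.shift x) ∂μ = ∫ x, g (Past.cons a x) * f x ∂μ := by
    intro a f hf
    rw [← integral_indicator (hmeas a), ← hμ _ ?_]
    · congr 1 with x
      rw [hT, Finset.sum_eq_single a]
      · rw [Set.indicator_of_mem (by rfl), shift_cons]
      · intro b _ hb
        rw [Set.indicator_of_notMem (by exact hb), mul_zero]
      · exact fun h => absurd (Finset.mem_univ a) h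
    · exact (hf.comp continuous_shift).indicator (fun x hx => by
        rw [(hopen a).frontier_eq] at hx; exact hx.elim)
  -- Finite measures are determined by integrals of bounded continuous functions, so the identity
  -- passes to all Borel sets.
  have hmap : ∀ a : ℤˣ, (μ.restrict {x : Past ℤˣ | x 0 = a}).map Past.shift =
      μ.withDensity fun x => ENNReal.ofReal (g (Past.cons a x)) := by
    intro a
    have : IsFiniteMeasure (μ.withDensity fun x => ENNReal.ofReal (g (Past.cons a x))) :=
      isFiniteMeasure_withDensity_ofReal
        ((integrable_const (1 : ℝ)).mono' (hgc a).aestronglyMeasurable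
          (ae_of_all _ fun x => by
            rw [Real.norm_of_nonneg (hg0 a x)]; exact hgle a x)).2
    refine ext_of_forall_integral_eq_of_IsFiniteMeasure fun f => ?_
    rw [integral_map hshift.aemeasurable f.continuous.aestronglyMeasurable,
      hcyl a f f.continuous, integral_withDensity_eq_integral_toReal_smul
        (hgc a).measurable.ennreal_ofReal (ae_of_all _ fun x => ENNReal.ofReal_lt_top)]
    congr 1 with x
    rw [ENNReal.toReal_ofReal (hg0 a x), smul_eq_mul]
  have hset : ∀ (a : ℤˣ) (s : Set (Past ℤˣ)), MeasurableSet s →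
      μ (Past.shift ⁻¹' s ∩ {x | x 0 = a}) = ∫⁻ x in s, ENNReal.ofReal (g (Past.cons a x)) ∂μ := by
    intro a s hs
    rw [← withDensity_apply _ hs, ← hmap a, Measure.map_apply hshift hs,
      Measure.restrict_apply (hshift hs)]
  have hinv : MeasurePreserving (Past.shift : Past ℤˣ → Past ℤˣ) μ μ := by
    refine ⟨hshift, Measure.ext fun s hs => ?_⟩
    rw [Measure.map_apply hshift hs]
    have hdisj : Past.shift ⁻¹' s \ {x : Past ℤˣ | x 0 = 1} =
        Past.shift ⁻¹' s ∩ {x : Past ℤˣ | x 0 = -1} := by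
      ext x
      rcases Int.units_eq_one_or (x 0) with h | h <;> simp [h]
    rw [← measure_inter_add_sdiff _ (hmeas 1), hdisj, hset 1 s hs, hset (-1) s hs,
      ← lintegral_add_left (hgc 1).measurable.ennreal_ofReal]
    -- Invariance amounts to the two cylinder densities adding up to `1`.
    have : ∀ x, ENNReal.ofReal (g (Past.cons 1 x)) + ENNReal.ofReal (g (Past.cons (-1) x)) = 1 := by
      intro x
      rw [← ENNReal.ofReal_add (hg0 1 x) (hg0 (-1) x), hg1, hg2]
      simp
    simp only [this, lintegral_one, Measure.restrict_apply_univ]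
  refine ⟨inferInstance, hinv, fun a => ?_⟩
  have hle : MeasurableSpace.comap (Past.shift : Past ℤˣ → Past ℤˣ) inferInstance ≤
      (inferInstance : MeasurableSpace (Past ℤˣ)) := hshift.comap_le
  have hgi : Integrable (fun x => g (Past.cons a (Past.shift x))) μ :=
    (integrable_const (1 : ℝ)).mono' ((hgc a).comp continuous_shift).aestronglyMeasurable
      (ae_of_all _ fun x => by rw [Real.norm_of_nonneg (hg0 a _)]; exact hgle a _)
  refine (ae_eq_condExp_of_forall_setIntegral_eq hle
    ((integrable_const (1 : ℝ)).indicator (hmeas a)) (fun s _ _ => hgi.integrableOn) ?_ ?_).symm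
  · rintro _ ⟨s, hs, rfl⟩ -
    rw [integral_indicator (hmeas a), Measure.restrict_restrict (hmeas a), integral_const,
      smul_eq_mul, mul_one, Measure.real, Measure.restrict_apply_univ, Set.inter_comm,
      hset a s hs,
      ← setIntegral_map hs (f := fun x => g (Past.cons a x))
        (hgc a).aestronglyMeasurable hshift.aemeasurable, hinv.map_eq,
      integral_eq_lintegral_of_nonneg_ae (ae_of_all _ fun x => hg0 a x)
        (hgc a).aestronglyMeasurable]
  · exact (((hgc a).measurable.comp (comap_measurable _)).stronglyMeasurable).aestronglyMeasurable

end GMeasure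

/-! ### Continuity and symmetry of the model, and the conclusion -/

theorem continuous_symbol : Continuous symbol :=
  (continuous_of_discreteTopology (f := fun a : ℤˣ => ((a : ℤ) : ℝ))).comp (continuous_apply 0)

theorem continuous_majority (n : ℕ) : Continuous (majority n) := by
  have h : Continuous fun x : Past ℤˣ => ∑ l ∈ Finset.range n, (x l : ℤ) :=
    continuous_finsetSum _ fun l _ =>
      (continuous_of_discreteTopology (f := fun a : ℤˣ => (a : ℤ))).comp (continuous_apply l)
  exact (continuous_of_discreteTopology (f := fun k : ℤ => ((k.sign : ℤ) : ℝ))).comp h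

section Model

variable {ε : ℝ} {lam : ℕ → ℝ} {m : ℕ → ℕ}

theorem continuous_fullProb (hlam : ∀ j, 1 ≤ j → 0 < lam j)
    (hsum : HasSum (fun j : ℕ => lam (j + 1)) 1) : Continuous (fullProb ε lam m) := by
  refine continuous_const.add (continuous_const.mul (continuous_tsum
    (fun j => continuous_const.mul (continuous_majority _)) hsum.summable fun j x => ?_))
  have hj := hlam (j + 1) (by omega)
  rw [Real.norm_eq_abs, abs_mul, abs_of_pos hj]
  nlinarith [abs_majority_le_one (m (j + 1)) x]

theorem fullProb_neg (x : Past ℤˣ) : fullProb ε lam m (-x) = 1 - fullProb ε lam m x := by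
  simp only [fullProb, majority_neg, mul_neg, tsum_neg]
  ring

theorem kernel_cons (hm_odd : ∀ j, 1 ≤ j → Odd (m j)) (hlam : ∀ j, 1 ≤ j → 0 < lam j)
    (hsum : HasSum (fun j : ℕ => lam (j + 1)) 1) (a : ℤˣ) (x : Past ℤˣ) :
    kernel ε lam m (Past.cons a x) = 1 / 2 +
      (1 / 2 - ε) * (((a : ℤ) : ℝ) * ∑' j : ℕ, lam (j + 1) * majority (m (j + 1)) x) := by
  have hS := (summable_majority (m := m) hlam hsum x).hasSum.mul_left
    ((1 / 2 - ε) * ((a : ℤ) : ℝ))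
  have := (hsum.mul_right (1 / 2)).add hS
  rw [one_mul] at this
  rw [kernel, ← mul_assoc (1 / 2 - ε), ← this.tsum_eq]
  refine tsum_congr fun j => ?_
  rw [majorityKernel_cons ε (hm_odd (j + 1) (by omega))]
  ring

end Model

end BramsonKalikow

theorem theorem3 (ε : ℝ) (hε0 : 0 < ε) (hε : ε < 1 / 2)
    (m : ℕ → ℕ) (hm0 : m 0 = 0) (hm_mono : StrictMono m) (hm_odd : ∀ j, 1 ≤ j → Odd (m j))
    (lam : ℕ → ℝ) (hlam_pos : ∀ j, 1 ≤ j → 0 < lam j)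
    (hlam_sum : HasSum (fun j : ℕ => lam (j + 1)) 1)
    (r : ℕ → ℕ) (hr : ∀ k, 1 ≤ k → r k < k)
    (α : ℝ) (hα0 : 0 < α) (hα : α < 1 / 2 - ε)
    (hgap : ∀ k : ℕ,
      ∑ j ∈ Finset.Icc (r (k + 1) + 1) (k + 1), lam j < ∑' j : ℕ, lam (k + 2 + j))
    (hm : ∀ k : ℕ,
      BramsonKalikow.constA ε α m r k / BramsonKalikow.gap lam r k ^ 2 ≤ (m (k + 1) : ℝ)) :
    ∃ μ ν : MeasureTheory.Measure (Past ℤˣ), μ ≠ ν ∧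
      IsGMeasure (BramsonKalikow.kernel ε lam m) μ ∧
      IsGMeasure (BramsonKalikow.kernel ε lam m) ν := by
  open BramsonKalikow in
  have hu : Continuous (fullProb ε lam m) := continuous_fullProb hlam_pos hlam_sum
  have h0 : ∀ x, 0 ≤ fullProb ε lam m x := fun x =>
    (fullProb_mem hε0 hε hlam_pos hlam_sum x).1
  have h1 : ∀ x, fullProb ε lam m x ≤ 1 := fun x =>
    (fullProb_mem hε0 hε hlam_pos hlam_sum x).2
  have hg1 : ∀ x, kernel ε lam m (Past.cons 1 x) = fullProb ε lam m x := fun x => by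
    rw [kernel_cons hm_odd hlam_pos hlam_sum, fullProb]
    simp
  have hg2 : ∀ x, kernel ε lam m (Past.cons (-1) x) = 1 - fullProb ε lam m x := fun x => by
    rw [kernel_cons hm_odd hlam_pos hlam_sum, fullProb]
    push_cast
    ring
  have hplus := le_transfer_full hε0 hε hm_mono hlam_pos hlam_sum hr hα0 hgap hm
  have hminus : ∀ n, 1 - 2 * ε - 2 * α ≤ (transfer (fullProb ε lam m) ^ n) (-symbol) (-1) := by
    intro n
    rw [map_neg, Pi.neg_apply, transfer_pow_odd fullProb_neg symbol_neg, neg_neg]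
    exact hplus n
  obtain ⟨μ, hμp, hμ, hμ1⟩ := exists_stationary hu h0 h1 1
  obtain ⟨ν, hνp, hν, hν1⟩ := exists_stationary hu h0 h1 (-1)
  refine ⟨μ, ν, ?_, isGMeasure_of_stationary hu h0 h1 hg1 hg2 hμ,
    isGMeasure_of_stationary hu h0 h1 hg1 hg2 hν⟩
  -- A common measure would give `symbol` a mean both at least `1 - 2ε - 2α` and at most its
  -- negative, while `α < 1 / 2 - ε` makes this number positive.
  rintro rfl
  have a := hμ1 symbol continuous_symbol _ hplus
  have b := hν1 (-symbol) continuous_symbol.neg _ hminus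
  simp only [Pi.neg_apply, integral_neg] at b
  linarith
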